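/- Let $X\subset\mathbb{CP}^3$ be a smooth irreducible closed algebraic curve that is not contained in a plane. For a point $O\in\mathbb{CP}^3$, a projection with centre $O$ is given by a $3\times4$ complex matrix $M$ whose kernel is exactly the line of $\mathbb C^4$ representing $O$; it sends a point $P\neq O$ to $MP\in\mathbb{CP}^2$. For a plane curve $Y\subset\mathbb{CP}^2$, the dual curve $Y^\star$ is the Zariski closure, in the dual plane, of the set of tangent lines to $Y$ at its smooth points. Lines of $\mathbb{CP}^2$ are identified with points $l$ of the dual plane by $l^Tw=0$. Then there is a non-empty Zariski open subset $U$ of $\mathbb{CP}^3\times\mathbb{CP}^3$, depending only on $X$, such that the following holds for every $(O_1,O_2)\in U$ and all projection matrices $M_1,M_2$ with centres $O_1,O_2$. Let $Y_i$ be the image of $X$ under $M_i$, and let $\phi_i$ be an equation of $Y_i^\star$, that is, a square-free homogeneous polynomial in three variables with zero locus $Y_i^\star$ ($i=1,2$). Let $\mathbf e_1\neq0$ be a vector representing the first epipole, the image of $O_2$ under $M_1$. Let $\mathbf F$ be the fundamental matrix of the pair, the $3\times3$ matrix with entries $$F_{ij}=\det\big(m^{(2)}_{i+1},\,m^{(2)}_{i+2},\,m^{(1)}_{j+1},\,m^{(1)}_{j+2}\big),$$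 where $m^{(k)}_1,m^{(k)}_2,m^{(k)}_3$ are the rows of $M_k$ and indices are taken modulo $3$; it sends a point $\mathbf p$ of the first plane, different from the epipole, to the line of the second plane that is the image under $M_2$ of the line in space projected by $M_1$ to $\mathbf p$. Then there is a non-zero scalar $\lambda\in\mathbb C$ such that $$\phi_2(\mathbf F\mathbf p)=\lambda\,\phi_1(\mathbf e_1\times\mathbf p)\qquad\text{for all }\mathbf p\in\mathbb C^3 .$$ -/

import Mathlib

open scoped Matrix LinearAlgebra.Projectivization Topology

namespace Kruppa

/-- Complex projective `n`-space. -/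
abbrev PP (n : ℕ) : Type := ℙ ℂ (Fin (n + 1) → ℂ)

/-- The zero locus of a homogeneous polynomial in projective space. -/
def hypersurface {n : ℕ} (f : MvPolynomial (Fin (n + 1)) ℂ) : Set (PP n) :=
  {P | MvPolynomial.eval P.rep f = 0}

/-- The Zariski topology on projective space: the complements of the hypersurfaces defined by
homogeneous polynomials form a basis of open sets. -/
instance zariski (n : ℕ) : TopologicalSpace (PP n) :=
  TopologicalSpace.generateFrom
    {U | ∃ (f : MvPolynomial (Fin (n + 1)) ℂ) (d : ℕ), f.IsHomogeneous d ∧ U = (hypersurface f)ᶜ}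

/-- The Zariski topology on `ℙ³ × ℙ³` (not the product topology): the non-vanishing loci of
bihomogeneous polynomials in two groups of four variables form a basis of open sets. -/
@[reducible] def zariskiProd : TopologicalSpace (PP 3 × PP 3) :=
  TopologicalSpace.generateFrom
    {U | ∃ (G : MvPolynomial (Fin 4 ⊕ Fin 4) ℂ) (a b : ℕ),
      MvPolynomial.IsWeightedHomogeneous (Sum.elim (fun _ => 1) (fun _ => 0) : _ → ℕ) G a ∧
      MvPolynomial.IsWeightedHomogeneous (Sum.elim (fun _ => 0) (fun _ => 1) : _ → ℕ) G b ∧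
      U = {O | MvPolynomial.eval (Sum.elim O.1.rep O.2.rep) G ≠ 0}}

/-- The affine cone over a subset of projective space, without its vertex. -/
def cone {n : ℕ} (X : Set (PP n)) : Set (Fin (n + 1) → ℂ) :=
  {v | ∃ h : v ≠ 0, Projectivization.mk ℂ v h ∈ X}

/-- The ideal of polynomials vanishing on a subset of projective space. -/
noncomputable def idealOf {n : ℕ} (X : Set (PP n)) : Ideal (MvPolynomial (Fin (n + 1)) ℂ) :=
  MvPolynomial.vanishingIdeal ℂ (cone X)

/-- The embedded projective tangent space of `X` at `P`, as a linear subspace of `ℂⁿ⁺¹`: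
the common kernel of the differentials at `P` of all polynomials that vanish on `X`. -/
noncomputable def tangentSpace {n : ℕ} (X : Set (PP n)) (P : PP n) :
    Submodule ℂ (Fin (n + 1) → ℂ) where
  carrier := {w | ∀ f ∈ idealOf X,
    ∑ i, MvPolynomial.eval P.rep (MvPolynomial.pderiv i f) * w i = 0}
  add_mem' := by
    intro a b ha hb f hf
    simp [mul_add, Finset.sum_add_distrib, ha f hf, hb f hf]
  zero_mem' := by
    intro f _
    simp
  smul_mem' := by
    intro c a ha f hf
    have h := congrArg (c * ·) (ha f hf)
    simp only [Finset.mul_sum, mul_zero] at h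
    rw [← h]
    exact Finset.sum_congr rfl fun i _ => by simp; ring

/-- `P` is a smooth point of the curve `X`: the tangent space is a projective line. -/
def IsSmoothPoint {n : ℕ} (X : Set (PP n)) (P : PP n) : Prop :=
  P ∈ X ∧ Module.finrank ℂ (tangentSpace X P) = 2

/-- A smooth irreducible closed algebraic curve in projective space. -/
structure IsSmoothIrreducibleCurve {n : ℕ} (X : Set (PP n)) : Prop where
  closed : IsClosed X
  irreducible : IsIrreducible X
  dim_one : topologicalKrullDim X = 1
  smooth : ∀ P ∈ X, IsSmoothPoint X P

/-- `X` is contained in a plane of `ℙ³`. -/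
def IsPlanar (X : Set (PP 3)) : Prop :=
  ∃ h : Fin 4 → ℂ, h ≠ 0 ∧ ∀ P ∈ X, h ⬝ᵥ P.rep = 0

/-- The matrix `M` presents a projection `ℙ³ ∖ {O} → ℙ²` with centre `O`: its kernel is exactly
the line of `ℂ⁴` that represents `O` (so `M` has rank three). -/
def IsProjectionFrom (M : Matrix (Fin 3) (Fin 4) ℂ) (O : PP 3) : Prop :=
  LinearMap.ker M.mulVecLin = O.submodule

/-- The image of `X` under the projection `P ↦ M P`. -/
def projectedCurve (M : Matrix (Fin 3) (Fin 4) ℂ) (X : Set (PP 3)) : Set (PP 2) :=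
  {Q | ∃ P ∈ X, ∃ h : M *ᵥ P.rep ≠ 0, Q = Projectivization.mk ℂ (M *ᵥ P.rep) h}

/-- The dual curve of a plane curve: the Zariski closure of the set of tangent lines at smooth
points. The line `{w | l ⬝ᵥ w = 0}` is the point `l` of the dual plane. -/
def dualCurve (Y : Set (PP 2)) : Set (PP 2) :=
  closure {l | ∃ P, IsSmoothPoint Y P ∧ ∀ w ∈ tangentSpace Y P, l.rep ⬝ᵥ w = 0}

/-- `φ` is the (reduced) equation of the plane curve `C`. -/
def IsEquationOf (φ : MvPolynomial (Fin 3) ℂ) (C : Set (PP 2)) : Prop :=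
  (∃ d : ℕ, φ.IsHomogeneous d) ∧ Squarefree φ ∧ C = hypersurface φ

/-- The fundamental matrix of the projections `M₁`, `M₂`. If `Γ, Λ, Θ` are the rows of `M₁`, the
optical ray of `p = (x, y, z)` is the extensor `x Λ ∧ Θ + y Θ ∧ Γ + z Γ ∧ Λ`; the `i`-th coordinate
of the image under `M₂` of a line is its pairing (wedge product, i.e. a `4 × 4` determinant) with
the meet of the rows `i + 1` and `i + 2` (indices modulo three) of `M₂`. -/
noncomputable def fundamentalMatrix (M₁ M₂ : Matrix (Fin 3) (Fin 4) ℂ) : Matrix (Fin 3) (Fin 3) ℂ :=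
  Matrix.of fun i j =>
    Matrix.det (Matrix.of ![M₂ (i + 1), M₂ (i + 2), M₁ (j + 1), M₁ (j + 2)])

/-- The vector `e` represents the epipole in the plane of `M`, the image under `M` of the other
centre `O`. -/
def IsEpipole (e : Fin 3 → ℂ) (M : Matrix (Fin 3) (Fin 4) ℂ) (O : PP 3) : Prop :=
  e ≠ 0 ∧ ∃ v ∈ O.submodule, e = M *ᵥ v

end Kruppa

/-! The planes of space containing a tangent line of `X` form the dual surface of `X`, which does
not depend on any projection. Let `Φ`, of degree `d`, be its equation. A projection matrix `M` with
centre `O` identifies a line `l` of the image plane with the plane `Mᵀ l` through `O`. If `O` lies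
on no tangent line of `X`, then `l` belongs to the dual of the projected curve exactly when `Φ (Mᵀ
l) = 0`. If moreover the section of the dual surface by the plane dual to `O` is reduced, then `Φ
(Mᵀ l)` is square-free, so `φᵢ (l) = cᵢ Φ (Mᵢᵀ l)` with a nonzero constant `cᵢ`
(`IsEquationOf.exists_eq_C_mul_pullback`). Both conditions on `O` hold outside a hypersurface
(`exists_generic_centre`).

The two image planes are compared by `exists_fundamentalMatrix_vecMul`: `M₂ᵀ F p = κ M₁ᵀ (e₁ × p)`
with `κ ≠ 0`, since both sides represent the epipolar plane of `p`. Applying `Φ` gives the theorem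
with `λ = c₂ κ ^ d / c₁`.

Most of the work is the existence of `Φ` (`exists_dual_equation`). A prime ideal with no nonzero
element free of some variable is principal, by a resultant argument. For the dual surface such a
variable exists, for otherwise all tangent lines of `X` would coincide and `X` would be planar. The
ideal is nonzero because a one-parameter family of planes in `ℂ⁴` sweeps out at most a hypersurface;
this rests on the bound `trdeg_chart_le_one`. Elimination theory (`exists_separating_polynomial`)
shows that the dual cone is closed, hence is the whole zero set of `Φ`. -/

namespace Kruppa

open MvPolynomial

/-! ### Restriction of polynomials to lines, homogeneous components -/

/-- Chain rule for a derivation applied to a polynomial expression. -/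
theorem derivation_aeval {σ R A M : Type*} [Fintype σ] [CommRing R] [CommRing A] [Algebra R A]
    [AddCommGroup M] [Module A M] [Module R M] (D : Derivation R A M)
    (g : σ → A) (f : MvPolynomial σ R) :
    D (aeval g f) = ∑ j, aeval g (pderiv j f) • D (g j) := by
  classical
  induction f using MvPolynomial.induction_on with
  | C a => simp
  | add p q hp hq => simp [hp, hq, add_smul, Finset.sum_add_distrib]
  | mul_X p i hp =>
    simp only [map_mul, aeval_X, Derivation.leibniz, hp, pderiv_X, map_add, smul_eq_mul]
    simp only [add_smul, Finset.sum_add_distrib, Finset.smul_sum, mul_smul]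
    congr 1
    rw [Finset.sum_eq_single i]
    · simp
    · intro j _ hj
      simp [hj]
    · simp

/-- The restriction of a polynomial to the line `s ↦ u + s v`. -/
noncomputable def restrictLine {σ : Type*} (u v : σ → ℂ) :
    MvPolynomial σ ℂ →ₐ[ℂ] Polynomial ℂ :=
  aeval fun i => Polynomial.C (u i) + Polynomial.C (v i) * Polynomial.X

theorem eval_restrictLine {σ : Type*} (u v : σ → ℂ) (f : MvPolynomial σ ℂ) (s : ℂ) :
    (restrictLine u v f).eval s = eval (u + s • v) f := by
  have : (Polynomial.evalRingHom s).comp (restrictLine u v : _ →+* Polynomial ℂ)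
      = eval (u + s • v) := by
    apply MvPolynomial.ringHom_ext
    · intro r; simp [restrictLine]
    · intro i
      simp only [restrictLine, RingHom.comp_apply, RingHom.coe_coe, aeval_X, eval_X]
      simp
      ring
  exact congrArg (fun φ => φ f) this

theorem natDegree_restrictLine_le {σ : Type*} (u v : σ → ℂ) (f : MvPolynomial σ ℂ) :
    (restrictLine u v f).natDegree ≤ f.totalDegree := by
  refine (aeval_natDegree_le f le_rfl _ (n := 1) ?_).trans (by simp)
  intro i
  compute_degree

theorem coeff_prod_linear_pow {σ : Type*} (u v : σ → ℂ) (m : σ → ℕ) (s : Finset σ) :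
    (∏ a ∈ s, (Polynomial.C (u a) + Polynomial.C (v a) * Polynomial.X) ^ m a).coeff (∑ a ∈ s, m a)
      = ∏ a ∈ s, v a ^ m a := by
  classical
  have hlin : ∀ a, (Polynomial.C (u a) + Polynomial.C (v a) * Polynomial.X).natDegree ≤ 1 := by
    intro a; compute_degree
  have hpow : ∀ a, ((Polynomial.C (u a) + Polynomial.C (v a) * Polynomial.X) ^ m a).natDegree
      ≤ m a := fun a => by simpa using Polynomial.natDegree_pow_le_of_le (m a) (hlin a)
  induction s using Finset.induction_on with
  | empty => simp
  | insert a s ha ih =>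
    rw [Finset.prod_insert ha, Finset.sum_insert ha, Finset.prod_insert ha,
      Polynomial.coeff_mul_add_eq_of_natDegree_le (hpow a)
        ((Polynomial.natDegree_prod_le _ _).trans (Finset.sum_le_sum fun b _ => hpow b)), ih]
    congr 1
    have := Polynomial.coeff_pow_of_natDegree_le (m := m a) (hlin a)
    simpa using this

/-- Only the terms in `s` of the linear factors reach degree `d`. Thus a form keeps its full degree
on the line exactly when it does not vanish at the direction `v`. -/
theorem coeff_restrictLine {σ : Type*} (u v : σ → ℂ) {f : MvPolynomial σ ℂ} {d : ℕ}
    (hf : f.IsHomogeneous d) : (restrictLine u v f).coeff d = eval v f := by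
  classical
  rw [f.as_sum]
  simp only [map_sum, Polynomial.finsetSum_coeff]
  refine Finset.sum_congr rfl fun m hm => ?_
  have hd : ∑ i ∈ m.support, m i = d := by
    by_contra h
    exact (mem_support_iff.1 hm) (hf.coeff_eq_zero h)
  rw [restrictLine, aeval_monomial, eval_monomial, Finsupp.prod, Finsupp.prod,
    Polynomial.algebraMap_eq, Polynomial.coeff_C_mul, ← hd, coeff_prod_linear_pow]

theorem derivative_restrictLine {σ : Type*} [Fintype σ] (u v : σ → ℂ) (f : MvPolynomial σ ℂ) :
    Polynomial.derivative (restrictLine u v f) =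
      ∑ i, restrictLine u v (pderiv i f) * Polynomial.C (v i) := by
  have := derivation_aeval (Polynomial.derivative' (R := ℂ))
    (fun i => Polynomial.C (u i) + Polynomial.C (v i) * Polynomial.X) f
  simpa [restrictLine] using this

theorem IsHomogeneous.eval_smul {σ : Type*} {f : MvPolynomial σ ℂ} {d : ℕ}
    (hf : f.IsHomogeneous d) (c : ℂ) (v : σ → ℂ) : eval (c • v) f = c ^ d * eval v f := by
  classical
  rw [f.as_sum]
  simp only [map_sum, Finset.mul_sum]
  refine Finset.sum_congr rfl fun m hm => ?_
  have hd : ∑ i ∈ m.support, m i = d := by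
    by_contra h
    exact (mem_support_iff.1 hm) (hf.coeff_eq_zero h)
  simp only [eval_monomial, Finsupp.prod, Pi.smul_apply, smul_eq_mul, mul_pow,
    Finset.prod_mul_distrib, Finset.prod_pow_eq_pow_sum, hd]
  ring

theorem eval_smul_eq_sum {σ : Type*} (f : MvPolynomial σ ℂ) (c : ℂ) (v : σ → ℂ) :
    eval (c • v) f =
      ∑ j ∈ Finset.range (f.totalDegree + 1), c ^ j * eval v (homogeneousComponent j f) := by
  conv_lhs => rw [← sum_homogeneousComponent f]
  simp [IsHomogeneous.eval_smul (homogeneousComponent_isHomogeneous _ f)]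

/-- The polynomial `c ↦ f (c v)`. -/
noncomputable def radial {σ : Type*} (f : MvPolynomial σ ℂ) (v : σ → ℂ) : Polynomial ℂ :=
  restrictLine 0 v f

theorem eval_radial {σ : Type*} (f : MvPolynomial σ ℂ) (v : σ → ℂ) (c : ℂ) :
    (radial f v).eval c = eval (c • v) f := by
  simp [radial, eval_restrictLine]

theorem coeff_radial {σ : Type*} (f : MvPolynomial σ ℂ) (v : σ → ℂ) (j : ℕ) :
    (radial f v).coeff j = eval v (homogeneousComponent j f) := by
  have : radial f v = ∑ j ∈ Finset.range (f.totalDegree + 1),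
      Polynomial.C (eval v (homogeneousComponent j f)) * Polynomial.X ^ j := by
    refine Polynomial.funext fun c => ?_
    rw [eval_radial, eval_smul_eq_sum, Polynomial.eval_finsetSum]
    exact Finset.sum_congr rfl fun j _ => by simp; ring
  rw [this]
  simp only [Polynomial.finsetSum_coeff, Polynomial.coeff_C_mul, Polynomial.coeff_X_pow]
  simp only [mul_ite, mul_one, mul_zero, Finset.sum_ite_eq, Finset.mem_range]
  split_ifs with h
  · rfl
  · rw [homogeneousComponent_eq_zero _ _ (by omega)]; simp

theorem polynomial_eq_zero_of_forall_ne_zero {p : Polynomial ℂ}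
    (h : ∀ c : ℂ, c ≠ 0 → p.eval c = 0) : p = 0 := by
  refine Polynomial.eq_zero_of_infinite_isRoot p
    (Set.Infinite.mono (s := {0}ᶜ) (fun c hc => h c hc) (Set.finite_singleton _).infinite_compl)

/-- The coefficients of `c ↦ f (c v)` are the values at `v` of the homogeneous components of `f`.
This passes from arbitrary polynomials to forms on sets stable under scaling. -/
theorem exists_smul_eval_ne_zero {σ : Type*} {f : MvPolynomial σ ℂ} {v : σ → ℂ} {j : ℕ}
    (h : eval v (homogeneousComponent j f) ≠ 0) : ∃ c : ℂ, c ≠ 0 ∧ eval (c • v) f ≠ 0 := by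
  by_contra! hc
  have : radial f v = 0 :=
    polynomial_eq_zero_of_forall_ne_zero fun c h0 => by rw [eval_radial, hc c h0]
  rw [← coeff_radial, this] at h
  simp at h

theorem exists_eval_ne_zero {σ : Type*} {f : MvPolynomial σ ℂ} (hf : f ≠ 0) :
    ∃ v, eval v f ≠ 0 := by
  by_contra! h
  exact hf (MvPolynomial.funext fun v => by simp [h])

/-! ### Principal prime ideals -/

/-- Bezout identity for a prime polynomial over a factorial domain. -/
theorem exists_bezout {R : Type*} [CommRing R] [IsDomain R] [UniqueFactorizationMonoid R]
    {P Q : Polynomial R} (hP : Prime P) (hdeg : P.natDegree ≠ 0) (hPQ : ¬ P ∣ Q) :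
    ∃ (a b : Polynomial R) (r : R), r ≠ 0 ∧ P * a + Q * b = Polynomial.C r := by
  classical
  let := Classical.choice (inferInstance : Nonempty (NormalizedGCDMonoid R))
  let K := FractionRing R
  obtain ⟨a, b, -, -, h⟩ := Polynomial.exists_mul_add_mul_eq_C_resultant P Q le_rfl le_rfl
    (Or.inl hdeg)
  refine ⟨a, b, _, ?_, h⟩
  -- Gauss's lemma: over the fraction field `P` stays irreducible and still does not divide `Q`. The
  -- two are then coprime, so their resultant is nonzero.
  have hprim : P.IsPrimitive := hP.irreducible.isPrimitive hdeg
  have hirr := hprim.irreducible_iff_irreducible_map_fraction_map (K := K) |>.1 hP.irreducible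
  have hinj := IsFractionRing.injective R K
  have hndvd : ¬ P.map (algebraMap R K) ∣ Q.map (algebraMap R K) := fun hd =>
    hPQ ((hprim.dvd_iff_fraction_map_dvd_fraction_map K).2 hd)
  have hcop : IsCoprime (P.map (algebraMap R K)) (Q.map (algebraMap R K)) :=
    (hirr.coprime_iff_not_dvd).2 hndvd
  intro h0
  have hr : Polynomial.resultant (P.map (algebraMap R K)) (Q.map (algebraMap R K)) = 0 := by
    rw [Polynomial.natDegree_map_eq_of_injective hinj,
      Polynomial.natDegree_map_eq_of_injective hinj, Polynomial.resultant_map_map, h0, map_zero]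
  exact (Polynomial.resultant_eq_zero_iff.1 hr).2 hcop

/-- A prime ideal that contains no nonzero polynomial free of the `i`-th variable is principal. -/
theorem exists_span_singleton_of_prime {n : ℕ} (i : Fin (n + 1))
    (p : Ideal (MvPolynomial (Fin (n + 1)) ℂ)) [hp : p.IsPrime]
    (hi : ∀ r : MvPolynomial (Fin n) ℂ, rename i.succAbove r ∈ p → r = 0) :
    ∃ Φ, p = Ideal.span {Φ} := by
  classical
  by_cases h0 : p = ⊥
  · exact ⟨0, by simp [h0]⟩
  let e : MvPolynomial (Fin (n + 1)) ℂ ≃ₐ[ℂ] Polynomial (MvPolynomial (Fin n) ℂ) :=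
    (renameEquiv ℂ (_root_.finSuccEquiv' i)).trans (optionEquivLeft ℂ (Fin n))
  have heC : ∀ r, e (rename i.succAbove r) = Polynomial.C r := by
    intro r
    have : (e : _ →ₐ[ℂ] _).comp (rename i.succAbove) = Polynomial.CAlgHom (R := ℂ) := by
      apply MvPolynomial.algHom_ext
      intro j
      simp [e, optionEquivLeft_apply]
    exact congrArg (fun φ => φ r) this
  obtain ⟨Φ, hΦp, hΦ⟩ := hp.exists_mem_prime_of_ne_bot h0
  have hΦ' : Prime (e Φ) := (MulEquiv.prime_iff e).2 hΦ
  have hdeg : (e Φ).natDegree ≠ 0 := by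
    intro hd
    obtain ⟨r, hr⟩ := Polynomial.natDegree_eq_zero.1 hd
    have h1 : Φ = rename i.succAbove r := e.injective (by rw [heC, hr])
    have := hi r (h1 ▸ hΦp)
    rw [this, map_zero] at h1
    exact hΦ.ne_zero h1
  refine ⟨Φ, le_antisymm (fun g hg => ?_) (by simpa [Ideal.span_le] using hΦp)⟩
  rw [Ideal.mem_span_singleton]
  by_contra hnd
  have hnd' : ¬ e Φ ∣ e g := fun h => hnd ((map_dvd_iff e).1 h)
  -- An element `g` of `p` not divisible by `Φ` would combine with `Φ` to a nonzero element of `p`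
  -- free of the `i`-th variable.
  obtain ⟨a, b, r, hr, hab⟩ := exists_bezout hΦ' hdeg hnd'
  apply hr
  apply hi
  have : rename i.succAbove r = Φ * e.symm a + g * e.symm b := by
    apply e.injective
    rw [heC, ← hab]
    simp
  rw [this]
  exact p.add_mem (p.mul_mem_right _ hΦp) (p.mul_mem_right _ hg)

/-! ### Cones, their ideals and tangent spaces, affine charts -/

section Cone

variable {n : ℕ} {X : Set (PP n)}

theorem mem_idealOf {f : MvPolynomial (Fin (n + 1)) ℂ} :
    f ∈ idealOf X ↔ ∀ v ∈ cone X, eval v f = 0 := by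
  simp [idealOf]

theorem smul_mem_cone {v : Fin (n + 1) → ℂ} (hv : v ∈ cone X) {c : ℂ} (hc : c ≠ 0) :
    c • v ∈ cone X := by
  obtain ⟨h, hX⟩ := hv
  refine ⟨smul_ne_zero hc h, ?_⟩
  rwa [(Projectivization.mk_eq_mk_iff' ℂ _ _ _ h).2 ⟨c, rfl⟩]

theorem rep_mem_cone {P : PP n} (hP : P ∈ X) : P.rep ∈ cone X :=
  ⟨P.rep_nonzero, by rwa [Projectivization.mk_rep]⟩

theorem ne_zero_of_mem_cone {v : Fin (n + 1) → ℂ} (hv : v ∈ cone X) : v ≠ 0 := hv.1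

theorem exists_rep_eq_smul {v : Fin (n + 1) → ℂ} (hv : v ∈ cone X) :
    ∃ P ∈ X, ∃ c : ℂ, c ≠ 0 ∧ P.rep = c • v := by
  obtain ⟨h, hX⟩ := hv
  obtain ⟨a, ha⟩ := Projectivization.exists_smul_eq_mk_rep ℂ v h
  exact ⟨_, hX, a, a.ne_zero, ha.symm⟩

/-- The tangent space at a nonzero vector of the cone. -/
noncomputable def tangentAt (X : Set (PP n)) (v : Fin (n + 1) → ℂ) :
    Submodule ℂ (Fin (n + 1) → ℂ) where
  carrier := {w | ∀ f ∈ idealOf X, ∑ i, eval v (pderiv i f) * w i = 0}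
  add_mem' := by
    intro a b ha hb f hf
    simp [mul_add, Finset.sum_add_distrib, ha f hf, hb f hf]
  zero_mem' := by
    intro f _
    simp
  smul_mem' := by
    intro c a ha f hf
    have h := congrArg (c * ·) (ha f hf)
    simp only [Finset.mul_sum, mul_zero] at h
    rw [← h]
    exact Finset.sum_congr rfl fun i _ => by simp; ring

theorem mem_tangentAt {v w : Fin (n + 1) → ℂ} :
    w ∈ tangentAt X v ↔ ∀ f ∈ idealOf X, ∑ i, eval v (pderiv i f) * w i = 0 := Iff.rfl

theorem tangentSpace_eq (P : PP n) : tangentSpace X P = tangentAt X P.rep := rfl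

/-- The cone is stable under scaling, so `f (c ·)` lies in the ideal along with `f`; the chain rule
compares the two gradients. -/
theorem tangentAt_le_smul {v : Fin (n + 1) → ℂ} {c : ℂ} (hc : c ≠ 0) :
    tangentAt X v ≤ tangentAt X (c • v) := by
  classical
  intro w hw f hf
  have hg : aeval (fun i => C c * MvPolynomial.X i) f ∈ idealOf X := by
    rw [mem_idealOf] at hf ⊢
    intro u hu
    have := hf _ (smul_mem_cone hu hc)
    rw [← this]
    have h2 : (eval u).comp (aeval (fun i => C c * MvPolynomial.X i) :
        MvPolynomial (Fin (n + 1)) ℂ →ₐ[ℂ] _).toRingHom = eval (c • u) := by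
      apply MvPolynomial.ringHom_ext <;> simp
    exact congrArg (fun φ => φ f) h2
  have h := hw _ hg
  have key : ∀ i, eval v (pderiv i (aeval (fun i => C c * MvPolynomial.X i) f)) =
      c * eval (c • v) (pderiv i f) := by
    intro i
    rw [derivation_aeval (pderiv i)]
    simp only [map_sum, smul_eq_mul, map_mul, Derivation.leibniz, pderiv_C, pderiv_X]
    rw [Finset.sum_eq_single i]
    · have h2 : (eval v).comp (aeval (fun i => C c * MvPolynomial.X i) :
          MvPolynomial (Fin (n + 1)) ℂ →ₐ[ℂ] _).toRingHom = eval (c • v) := by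
        apply MvPolynomial.ringHom_ext <;> simp
      have h3 := congrArg (fun φ => φ (pderiv i f)) h2
      simp only [RingHom.comp_apply, AlgHom.toRingHom_eq_coe, RingHom.coe_coe] at h3
      rw [h3]
      simp [mul_comm]
    · intro j _ hj
      simp [hj.symm]
    · simp
  simp only [key, mul_assoc, ← Finset.mul_sum] at h
  exact (mul_eq_zero.1 h).resolve_left hc

theorem tangentAt_smul {v : Fin (n + 1) → ℂ} {c : ℂ} (hc : c ≠ 0) :
    tangentAt X (c • v) = tangentAt X v := by
  refine le_antisymm ?_ (tangentAt_le_smul hc)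
  have := tangentAt_le_smul (X := X) (v := c • v) (inv_ne_zero hc)
  rwa [smul_smul, inv_mul_cancel₀ hc, one_smul] at this

/-- Euler's relation: a point of the cone lies in its own tangent space. -/
theorem self_mem_tangentAt {v : Fin (n + 1) → ℂ} (hv : v ∈ cone X) : v ∈ tangentAt X v := by
  intro f hf
  have h0 : radial f v = 0 := polynomial_eq_zero_of_forall_ne_zero fun c hc => by
    rw [eval_radial]; exact mem_idealOf.1 hf _ (smul_mem_cone hv hc)
  have h1 := derivative_restrictLine 0 v f
  rw [radial] at h0
  rw [h0] at h1
  have h2 := congrArg (Polynomial.eval 1) h1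
  simpa [Polynomial.eval_finsetSum, eval_restrictLine] using h2.symm

theorem isOpen_eval_rep_ne_zero {f : MvPolynomial (Fin (n + 1)) ℂ} {d : ℕ}
    (hf : f.IsHomogeneous d) : IsOpen {P : PP n | eval P.rep f ≠ 0} :=
  TopologicalSpace.isOpen_generateFrom_of_mem ⟨f, d, hf, rfl⟩

theorem idealOf_isPrime (hX : IsIrreducible X) : (idealOf X).IsPrime := by
  refine ⟨fun h => ?_, fun {f g} hfg => ?_⟩
  · obtain ⟨P, hP⟩ := hX.1
    have h1 : (1 : MvPolynomial (Fin (n + 1)) ℂ) ∈ idealOf X := h ▸ Submodule.mem_top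
    simpa using mem_idealOf.1 h1 _ (rep_mem_cone hP)
  · by_contra! hne
    -- Zariski open sets are given by forms, so `f` and `g` are replaced by homogeneous components
    -- not vanishing identically on `X`. Irreducibility gives a point `Z` where both are nonzero.
    have key : ∀ f, f ∉ idealOf X → ∃ j, ∃ P ∈ X, eval P.rep (homogeneousComponent j f) ≠ 0 := by
      intro f hf
      rw [mem_idealOf] at hf
      push Not at hf
      obtain ⟨v, hv, hvf⟩ := hf
      obtain ⟨P, hP, c, hc, hr⟩ := exists_rep_eq_smul hv
      refine by_contra fun hcon => hvf ?_
      push Not at hcon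
      have h3 := eval_smul_eq_sum f c⁻¹ P.rep
      rw [hr, smul_smul, inv_mul_cancel₀ hc, one_smul] at h3
      rw [h3]
      refine Finset.sum_eq_zero fun j _ => ?_
      rw [← hr, hcon j P hP, mul_zero]
    obtain ⟨i, P, hP, hPf⟩ := key f hne.1
    obtain ⟨j, Q, hQ, hQg⟩ := key g hne.2
    obtain ⟨Z, hZ, hZf, hZg⟩ := hX.2 _ _
      (isOpen_eval_rep_ne_zero (homogeneousComponent_isHomogeneous i f))
      (isOpen_eval_rep_ne_zero (homogeneousComponent_isHomogeneous j g)) ⟨P, hP, hPf⟩ ⟨Q, hQ, hQg⟩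
    have hprod : radial f Z.rep * radial g Z.rep = 0 :=
      polynomial_eq_zero_of_forall_ne_zero fun c hc => by
        rw [Polynomial.eval_mul, eval_radial, eval_radial, ← map_mul]
        exact mem_idealOf.1 hfg _ (smul_mem_cone (rep_mem_cone hZ) hc)
    rcases mul_eq_zero.1 hprod with h | h
    · exact hZf (by rw [← coeff_radial, h]; simp)
    · exact hZg (by rw [← coeff_radial, h]; simp)

/-- The affine chart `x₀ = 1` of `X`. -/
def chart (X : Set (PP n)) : Set (Fin n → ℂ) := {y | (Fin.cons 1 y : Fin (n + 1) → ℂ) ∈ cone X}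

/-- The homogenization of a polynomial, with respect to the variable of index zero. -/
noncomputable def homogenize (F : MvPolynomial (Fin n) ℂ) : MvPolynomial (Fin (n + 1)) ℂ :=
  ∑ j ∈ Finset.range (F.totalDegree + 1),
    MvPolynomial.X 0 ^ (F.totalDegree - j) * rename Fin.succ (homogeneousComponent j F)

theorem eval_homogenize (F : MvPolynomial (Fin n) ℂ) (y : Fin n → ℂ) (c : ℂ) :
    eval (c • (Fin.cons 1 y : Fin (n + 1) → ℂ)) (homogenize F) = c ^ F.totalDegree * eval y F := by
  conv_rhs => rw [← one_smul ℂ y, eval_smul_eq_sum, Finset.mul_sum]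
  rw [homogenize, map_sum]
  refine Finset.sum_congr rfl fun j hj => ?_
  have h1 : (c • (Fin.cons 1 y : Fin (n + 1) → ℂ)) ∘ Fin.succ = c • y := by
    ext i; simp
  rw [map_mul, map_pow, eval_X, eval_rename, h1,
    IsHomogeneous.eval_smul (homogeneousComponent_isHomogeneous j F), ← mul_assoc]
  have : j ≤ F.totalDegree := by simpa [Nat.lt_succ_iff] using hj
  simp [← pow_add, Nat.sub_add_cancel this]

theorem exists_chart_of_mem_cone {v : Fin (n + 1) → ℂ} (hv : v ∈ cone X) (h0 : v 0 ≠ 0) :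
    ∃ y ∈ chart X, v = v 0 • (Fin.cons 1 y : Fin (n + 1) → ℂ) := by
  have h : v = v 0 • (Fin.cons 1 (fun i => (v 0)⁻¹ * v i.succ) : Fin (n + 1) → ℂ) := by
    ext i
    refine Fin.cases ?_ (fun i => ?_) i <;> simp [h0]
  refine ⟨_, ?_, h⟩
  have h2 := smul_mem_cone hv (inv_ne_zero h0)
  rw [h, smul_smul] at h2
  simpa [chart, h0] using h2

/-- Multiplication by the zeroth variable kills the points at infinity, and primality then removes
this factor. -/
theorem mem_vanishingIdeal_chart_iff [(idealOf X).IsPrime] (h0 : MvPolynomial.X 0 ∉ idealOf X)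
    (F : MvPolynomial (Fin n) ℂ) :
    F ∈ vanishingIdeal ℂ (chart X) ↔ homogenize F ∈ idealOf X := by
  constructor
  · intro hF
    have : homogenize F * MvPolynomial.X 0 ∈ idealOf X := by
      rw [mem_idealOf]
      intro v hv
      by_cases hv0 : v 0 = 0
      · simp [hv0]
      · obtain ⟨y, hy, hvy⟩ := exists_chart_of_mem_cone hv hv0
        have hFy : eval y F = 0 := by simpa [coe_aeval_eq_eval] using hF y hy
        rw [map_mul, hvy, eval_homogenize, hFy]
        simp
    exact (Ideal.IsPrime.mem_or_mem inferInstance this).resolve_right h0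
  · intro hF y hy
    have h := mem_idealOf.1 hF _ hy
    have h2 := eval_homogenize F y 1
    rw [one_smul, h] at h2
    simpa [coe_aeval_eq_eval] using h2.symm

theorem chart_isPrime [hp : (idealOf X).IsPrime] (h0 : MvPolynomial.X 0 ∉ idealOf X) :
    (vanishingIdeal ℂ (chart X)).IsPrime := by
  refine ⟨fun h => ?_, fun {F G} hFG => ?_⟩
  · have h1 : (1 : MvPolynomial (Fin n) ℂ) ∈ vanishingIdeal ℂ (chart X) := h ▸ Submodule.mem_top
    have h2 := (mem_vanishingIdeal_chart_iff h0 _).1 h1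
    apply hp.ne_top
    rw [Ideal.eq_top_iff_one]
    convert! h2
    simp [homogenize, homogeneousComponent_zero]
  · have : homogenize F * homogenize G * MvPolynomial.X 0 ∈ idealOf X := by
      rw [mem_idealOf]
      intro v hv
      by_cases hv0 : v 0 = 0
      · simp [hv0]
      · obtain ⟨y, hy, hvy⟩ := exists_chart_of_mem_cone hv hv0
        have hFy : eval y F * eval y G = 0 := by
          simpa [coe_aeval_eq_eval] using hFG y hy
        rw [map_mul, map_mul, hvy, eval_homogenize, eval_homogenize]
        linear_combination (v 0 ^ F.totalDegree * v 0 ^ G.totalDegree *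
          eval (v 0 • (Fin.cons 1 y : Fin (n + 1) → ℂ)) (MvPolynomial.X 0)) * hFy
    rw [mem_vanishingIdeal_chart_iff h0, mem_vanishingIdeal_chart_iff h0]
    exact hp.mem_or_mem ((hp.mem_or_mem this).resolve_right h0)

end Cone

/-! ### Conormal spaces, dehomogenization -/

section Conormal

variable {n : ℕ} {X : Set (PP n)}

/-- The gradient at `v` of the elements of the ideal of `X`. -/
noncomputable def gradientMap (X : Set (PP n)) (v : Fin (n + 1) → ℂ) :
    (idealOf X).restrictScalars ℂ →ₗ[ℂ] (Fin (n + 1) → ℂ) where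
  toFun f i := eval v (pderiv i f.1)
  map_add' f g := by ext i; simp
  map_smul' c f := by ext i; simp [smul_eval]

/-- The space of gradients at `v` of polynomials vanishing on `X`. -/
noncomputable def conormalAt (X : Set (PP n)) (v : Fin (n + 1) → ℂ) :
    Submodule ℂ (Fin (n + 1) → ℂ) := LinearMap.range (gradientMap X v)

theorem mem_conormalAt {v h : Fin (n + 1) → ℂ} :
    h ∈ conormalAt X v ↔ ∃ f ∈ idealOf X, (fun i => eval v (pderiv i f)) = h := by
  simp [conormalAt, gradientMap, LinearMap.mem_range]

theorem tangentAt_eq_orthogonal (v : Fin (n + 1) → ℂ) :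
    tangentAt X v = LinearMap.BilinForm.orthogonal (dotProductBilin ℂ ℂ) (conormalAt X v) := by
  ext w
  rw [mem_tangentAt, LinearMap.BilinForm.mem_orthogonal_iff]
  simp only [mem_conormalAt]
  constructor
  · rintro h _ ⟨f, hf, rfl⟩
    exact h f hf
  · intro h f hf
    exact h _ ⟨f, hf, rfl⟩

theorem dotProductBilin_isRefl (m : ℕ) :
    LinearMap.BilinForm.IsRefl (dotProductBilin ℂ ℂ : LinearMap.BilinForm ℂ (Fin m → ℂ)) := by
  intro x y h
  change y ⬝ᵥ x = 0
  rw [dotProduct_comm]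
  exact h

theorem dotProductBilin_nondegenerate (m : ℕ) :
    LinearMap.BilinForm.Nondegenerate
      (dotProductBilin ℂ ℂ : LinearMap.BilinForm ℂ (Fin m → ℂ)) := by
  refine ⟨fun x h => ?_, fun x h => ?_⟩
  · exact dotProduct_eq_zero x fun w => h w
  · exact dotProduct_eq_zero x fun w => by rw [dotProduct_comm]; exact h w

theorem mem_conormalAt_iff_forall {v h : Fin (n + 1) → ℂ} :
    h ∈ conormalAt X v ↔ ∀ w ∈ tangentAt X v, h ⬝ᵥ w = 0 := by
  conv_lhs => rw [← LinearMap.BilinForm.orthogonal_orthogonal (dotProductBilin_nondegenerate _)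
    (dotProductBilin_isRefl _) (conormalAt X v), ← tangentAt_eq_orthogonal]
  rw [LinearMap.BilinForm.mem_orthogonal_iff]
  refine forall₂_congr fun w _ => ?_
  rw [dotProduct_comm]
  rfl

theorem finrank_tangentAt (v : Fin (n + 1) → ℂ) :
    Module.finrank ℂ (tangentAt X v) = n + 1 - Module.finrank ℂ (conormalAt X v) := by
  rw [tangentAt_eq_orthogonal, LinearMap.BilinForm.finrank_orthogonal
    (dotProductBilin_nondegenerate _)]
  simp

theorem conormalAt_smul {v : Fin (n + 1) → ℂ} {c : ℂ} (hc : c ≠ 0) :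
    conormalAt X (c • v) = conormalAt X v := by
  ext h
  rw [mem_conormalAt_iff_forall, mem_conormalAt_iff_forall, tangentAt_smul hc]

theorem finrank_conormalAt {X : Set (PP 3)} {v : Fin 4 → ℂ}
    (h : Module.finrank ℂ (tangentAt X v) = 2) : Module.finrank ℂ (conormalAt X v) = 2 := by
  rw [finrank_tangentAt] at h
  omega

/-- Setting the variable of index zero equal to one. -/
noncomputable def dehomogenize : MvPolynomial (Fin (n + 1)) ℂ →ₐ[ℂ] MvPolynomial (Fin n) ℂ :=
  aeval (Fin.cons 1 MvPolynomial.X : Fin (n + 1) → MvPolynomial (Fin n) ℂ)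

theorem eval_dehomogenize (f : MvPolynomial (Fin (n + 1)) ℂ) (y : Fin n → ℂ) :
    eval y (dehomogenize f) = eval (Fin.cons 1 y : Fin (n + 1) → ℂ) f := by
  have : (eval y).comp (dehomogenize : MvPolynomial (Fin (n + 1)) ℂ →ₐ[ℂ] _).toRingHom =
      eval (Fin.cons 1 y : Fin (n + 1) → ℂ) := by
    apply MvPolynomial.ringHom_ext
    · simp
    · intro i
      refine Fin.cases ?_ (fun i => ?_) i <;> simp [dehomogenize]
  exact congrArg (fun φ => φ f) this

theorem pderiv_dehomogenize (f : MvPolynomial (Fin (n + 1)) ℂ) (i : Fin n) :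
    pderiv i (dehomogenize f) = dehomogenize (pderiv i.succ f) := by
  classical
  rw [dehomogenize, derivation_aeval (pderiv i), Fin.sum_univ_succ]
  simp only [Fin.cons_zero, Fin.cons_succ, Derivation.map_one_eq_zero, pderiv_X, smul_eq_mul]
  rw [mul_zero, zero_add]
  rw [Finset.sum_eq_single i]
  · simp
  · intro j _ hj
    simp [hj.symm]
  · simp

end Conormal

/-! ### Dimension of the curve and of families over it -/

section SpaceCurve

variable {X : Set (PP 3)}

/-- With a single generator `p`, all gradients at a point would be multiples of one vector: the last
three entries come from the gradient of `p`, and the zeroth is forced by Euler's relation. But the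
conormal space is two-dimensional. -/
theorem vanishingIdeal_chart_ne_span (hne : (chart X).Nonempty)
    (hT : ∀ v ∈ cone X, Module.finrank ℂ (tangentAt X v) = 2) (p : MvPolynomial (Fin 3) ℂ) :
    vanishingIdeal ℂ (chart X) ≠ Ideal.span {p} := by
  intro hJ
  obtain ⟨y, hy⟩ := hne
  have hv : (Fin.cons 1 y : Fin 4 → ℂ) ∈ cone X := hy
  have hpJ : p ∈ vanishingIdeal ℂ (chart X) := hJ ▸ Ideal.mem_span_singleton_self p
  have hpy : eval y p = 0 := by simpa [coe_aeval_eq_eval] using hpJ y hy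
  let z : Fin 4 → ℂ := Fin.cons (-∑ i, y i * eval y (pderiv i p)) fun i => eval y (pderiv i p)
  have hle : conormalAt X (Fin.cons 1 y : Fin 4 → ℂ) ≤ Submodule.span ℂ {z} := by
    intro h hh
    obtain ⟨f, hf, rfl⟩ := mem_conormalAt.1 hh
    have hfJ : dehomogenize f ∈ vanishingIdeal ℂ (chart X) := by
      intro u hu
      simpa [coe_aeval_eq_eval, eval_dehomogenize] using mem_idealOf.1 hf _ hu
    rw [hJ, Ideal.mem_span_singleton] at hfJ
    obtain ⟨q, hq⟩ := hfJ
    have h1 : ∀ i : Fin 3, eval (Fin.cons 1 y : Fin 4 → ℂ) (pderiv i.succ f) =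
        eval y q * eval y (pderiv i p) := by
      intro i
      rw [← eval_dehomogenize, ← pderiv_dehomogenize, hq]
      simp [Derivation.leibniz, hpy]
    have h2 := self_mem_tangentAt hv f hf
    rw [Fin.sum_univ_succ] at h2
    simp only [Fin.cons_zero, Fin.cons_succ, h1, mul_one] at h2
    rw [Submodule.mem_span_singleton]
    refine ⟨eval y q, ?_⟩
    ext i
    refine Fin.cases ?_ (fun i => ?_) i
    · simp only [z, Pi.smul_apply, Fin.cons_zero, smul_eq_mul]
      rw [eq_neg_of_add_eq_zero_left h2, mul_neg, Finset.mul_sum]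
      congr 1
      exact Finset.sum_congr rfl fun i _ => by ring
    · simp [z, h1]
  have h3 := Submodule.finrank_mono hle
  rw [finrank_conormalAt (hT _ hv)] at h3
  have : 2 ≤ 1 := h3.trans ((finrank_span_le_card ({z} : Set (Fin 4 → ℂ))).trans (by simp))
  omega

theorem exists_succAbove_eq_pair : ∀ i j : Fin 3, i ≠ j →
    ∃ k : Fin 3, (k.succAbove 0 = i ∧ k.succAbove 1 = j) ∨
      (k.succAbove 0 = j ∧ k.succAbove 1 = i) := by
  decide

/-- Two algebraically independent coordinate functions would mean that the ideal of the chart has no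
nonzero element free of the third variable. It would then be principal, against the rank of the
gradients. -/
theorem trdeg_chart_le_one [hp : (idealOf X).IsPrime] (h0 : MvPolynomial.X 0 ∉ idealOf X)
    (hT : ∀ v ∈ cone X, Module.finrank ℂ (tangentAt X v) = 2) :
    Algebra.trdeg ℂ (MvPolynomial (Fin 3) ℂ ⧸ vanishingIdeal ℂ (chart X)) ≤ 1 := by
  classical
  have hprime := chart_isPrime h0
  have hne : (chart X).Nonempty := by
    rw [Set.nonempty_iff_ne_empty]
    intro h
    exact hprime.ne_top (by rw [h, vanishingIdeal_empty])
  set A := MvPolynomial (Fin 3) ℂ ⧸ vanishingIdeal ℂ (chart X) with hA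
  let y : Fin 3 → A := fun i => Ideal.Quotient.mk _ (MvPolynomial.X i)
  have hay : ∀ r, aeval y r = Ideal.Quotient.mk (vanishingIdeal ℂ (chart X)) r := by
    intro r
    have : (aeval y : _ →ₐ[ℂ] A) = Ideal.Quotient.mkₐ ℂ (vanishingIdeal ℂ (chart X)) := by
      apply MvPolynomial.algHom_ext
      intro i
      rw [aeval_X]
      rfl
    exact congrArg (fun φ => φ r) this
  have htop : Algebra.adjoin ℂ (Set.range y) = ⊤ := by
    rw [Algebra.adjoin_range_eq_range_aeval, AlgHom.range_eq_top]
    intro a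
    obtain ⟨r, rfl⟩ := Ideal.Quotient.mk_surjective a
    exact ⟨r, hay r⟩
  have halg : Algebra.IsAlgebraic (Algebra.adjoin ℂ (Set.range y)) A := by
    refine ⟨fun a => ?_⟩
    have ha : a ∈ Algebra.adjoin ℂ (Set.range y) := htop ▸ Algebra.mem_top
    exact isAlgebraic_algebraMap (⟨a, ha⟩ : Algebra.adjoin ℂ (Set.range y))
  obtain ⟨t, hts, ht⟩ := exists_isTranscendenceBasis_subset (R := ℂ) (Set.range y)
  rw [← ht.cardinalMk_eq_trdeg]
  by_contra hcard
  rw [not_le, Cardinal.one_lt_iff_nontrivial] at hcard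
  obtain ⟨⟨a, ha⟩, ⟨b, hb⟩, hab⟩ := hcard
  obtain ⟨i, rfl⟩ := hts ha
  obtain ⟨j, rfl⟩ := hts hb
  have hij : i ≠ j := by rintro rfl; exact hab rfl
  have hyij : y i ≠ y j := fun h => hab (Subtype.ext h)
  obtain ⟨k, hk⟩ : ∃ k : Fin 3, (k.succAbove 0 = i ∧ k.succAbove 1 = j) ∨
      (k.succAbove 0 = j ∧ k.succAbove 1 = i) := by
    exact exists_succAbove_eq_pair i j hij
  have hmem : ∀ m : Fin 2, y (k.succAbove m) ∈ t := by
    intro m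
    fin_cases m <;> rcases hk with ⟨h1, h2⟩ | ⟨h1, h2⟩ <;> simp [h1, h2, ha, hb]
  have hinj : Function.Injective fun m : Fin 2 => (⟨y (k.succAbove m), hmem m⟩ : t) := by
    have h01 : y (k.succAbove 0) ≠ y (k.succAbove 1) := by
      rcases hk with ⟨h1, h2⟩ | ⟨h1, h2⟩ <;> rw [h1, h2]
      exacts [hyij, hyij.symm]
    intro m m' h
    have h' : y (k.succAbove m) = y (k.succAbove m') := congrArg Subtype.val h
    fin_cases m <;> fin_cases m'
    exacts [rfl, absurd h' h01, absurd h'.symm h01, rfl]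
  have hind := ht.1.comp _ hinj
  obtain ⟨p, hpJ⟩ := exists_span_singleton_of_prime k (vanishingIdeal ℂ (chart X)) (by
    intro r hr
    rw [← Ideal.Quotient.eq_zero_iff_mem, ← hay, aeval_rename] at hr
    exact (algebraicIndependent_iff.1 hind) r hr)
  exact vanishingIdeal_chart_ne_span hne hT p hpJ

/-- A family of `k`-dimensional linear spaces over the curve sweeps out a hypersurface of a space
of dimension `k + 2`. -/
theorem exists_eval_linear_combination_eq_zero [hp : (idealOf X).IsPrime]
    (h0 : MvPolynomial.X 0 ∉ idealOf X)
    (hT : ∀ v ∈ cone X, Module.finrank ℂ (tangentAt X v) = 2) (k : ℕ)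
    (w : Fin k → Fin (k + 2) → MvPolynomial (Fin 3) ℂ) :
    ∃ G : MvPolynomial (Fin (k + 2)) ℂ, G ≠ 0 ∧ ∀ y ∈ chart X, ∀ s : Fin k → ℂ,
      eval (fun i => ∑ j, s j * eval y (w j i)) G = 0 := by
  classical
  have hprime := chart_isPrime h0
  let A := MvPolynomial (Fin 3) ℂ ⧸ vanishingIdeal ℂ (chart X)
  let z : Fin (k + 2) → MvPolynomial (Fin k) A := fun i =>
    ∑ j, MvPolynomial.X j * C (Ideal.Quotient.mk _ (w j i))
  -- The generic combination `z` of the given vectors has `k + 2` entries in `A[t₁, …, tₖ]`, whose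
  -- transcendence degree is at most `k + 1`. An algebraic relation among the entries is the
  -- required `G`.
  have hz : ¬ AlgebraicIndependent ℂ z := by
    intro h
    have h1 := h.cardinalMk_le_trdeg
    have h2 := trdeg_add_eq ℂ A (A := MvPolynomial (Fin k) A)
    have h3 := MvPolynomial.trdeg_of_isDomain (ι := Fin k) (S := A)
    have h4 := trdeg_chart_le_one h0 hT
    rw [← h2, h3] at h1
    have h5 : (Cardinal.mk (Fin (k + 2))) ≤ 1 + Cardinal.lift.{0} (Cardinal.mk (Fin k)) :=
      h1.trans (by gcongr)
    simp only [Cardinal.mk_fin, Cardinal.lift_natCast] at h5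
    norm_cast at h5
    omega
  rw [algebraicIndependent_iff] at hz
  push Not at hz
  obtain ⟨G, hG, hG0⟩ := hz
  refine ⟨G, hG0, fun y hy s => ?_⟩
  let ev : A →+* ℂ := Ideal.Quotient.lift _ (eval y) fun f hf => by
    simpa [coe_aeval_eq_eval] using hf y hy
  have hev : ∀ f, ev (Ideal.Quotient.mk _ f) = eval y f := fun f => Ideal.Quotient.lift_mk _ _ _
  have h1 : (eval₂Hom ev s).comp (aeval z : _ →ₐ[ℂ] MvPolynomial (Fin k) A).toRingHom =
      eval (fun i => ∑ j, s j * eval y (w j i)) := by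
    apply MvPolynomial.ringHom_ext
    · intro r
      simp only [AlgHom.toRingHom_eq_coe, RingHom.comp_apply, RingHom.coe_coe, aeval_C, eval_C,
        IsScalarTower.algebraMap_apply ℂ A (MvPolynomial (Fin k) A), algebraMap_eq, coe_eval₂Hom,
        eval₂_C]
      have : algebraMap ℂ A r = Ideal.Quotient.mk _ (C r) := rfl
      rw [this, hev, eval_C]
    · intro i
      simp [z, hev]
  have h2 := congrArg (fun φ => φ G) h1
  simp only [AlgHom.toRingHom_eq_coe, RingHom.comp_apply, RingHom.coe_coe, hG, map_zero] at h2
  exact h2.symm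

end SpaceCurve

/-! ### Polynomial vector fields and the hypersurfaces they sweep out -/

/-- The value at `v` of a polynomial vector field. -/
noncomputable def evalField {σ ι : Type*} (v : σ → ℂ) (W : ι → MvPolynomial σ ℂ) : ι → ℂ :=
  fun i => eval v (W i)

theorem eval_evalField {σ ι : Type*} (v : σ → ℂ) (W : ι → MvPolynomial σ ℂ)
    (G : MvPolynomial ι ℂ) : eval (evalField v W) G = eval v (aeval W G) := by
  have : (eval v).comp (aeval W : MvPolynomial ι ℂ →ₐ[ℂ] MvPolynomial σ ℂ).toRingHom =
      eval (evalField v W) := by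
    apply MvPolynomial.ringHom_ext <;> simp [evalField]
  exact (congrArg (fun φ => φ G) this).symm

theorem mem_vanishingIdeal_iff_eval {σ : Type*} {V : Set (σ → ℂ)} {f : MvPolynomial σ ℂ} :
    f ∈ vanishingIdeal ℂ V ↔ ∀ x ∈ V, eval x f = 0 := by
  simp

section SpaceCurve

variable {X : Set (PP 3)}

/-- A polynomial that vanishes on a nonempty open part of an irreducible variety vanishes everywhere
on it. -/
theorem mem_idealOf_of_mul_mem [hp : (idealOf X).IsPrime] {f g : MvPolynomial (Fin 4) ℂ}
    (hg : g ∉ idealOf X) (h : ∀ v ∈ cone X, eval v g ≠ 0 → eval v f = 0) : f ∈ idealOf X := by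
  refine (hp.mem_or_mem (x := f) (y := g) ?_).resolve_right hg
  rw [mem_idealOf]
  intro v hv
  by_cases hgv : eval v g = 0
  · simp [hgv]
  · simp [h v hv hgv]

/-- A two-dimensional family of linear subspaces over the curve that is generated by polynomial
vector fields lies in a hypersurface. -/
theorem exists_forall_eval_eq_zero [hp : (idealOf X).IsPrime]
    (h0 : MvPolynomial.X 0 ∉ idealOf X)
    (hT : ∀ v ∈ cone X, Module.finrank ℂ (tangentAt X v) = 2)
    (E : (Fin 4 → ℂ) → Submodule ℂ (Fin 4 → ℂ))
    (hsmul : ∀ (c : ℂ) (v : Fin 4 → ℂ), c ≠ 0 → E (c • v) = E v)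
    (hdim : ∀ v ∈ cone X, Module.finrank ℂ (E v) = 2)
    (hgen : ∀ v ∈ cone X, ∀ w ∈ E v, ∃ W : Fin 4 → MvPolynomial (Fin 4) ℂ,
      (∀ u ∈ cone X, evalField u W ∈ E u) ∧ evalField v W = w) :
    ∃ G : MvPolynomial (Fin 4) ℂ, G ≠ 0 ∧ ∀ v ∈ cone X, ∀ w ∈ E v, eval w G = 0 := by
  classical
  have hprime := chart_isPrime h0
  obtain ⟨y₀, hy₀⟩ : (chart X).Nonempty := by
    rw [Set.nonempty_iff_ne_empty]
    intro h
    exact hprime.ne_top (by rw [h, vanishingIdeal_empty])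
  have hv₀ : (Fin.cons 1 y₀ : Fin 4 → ℂ) ∈ cone X := hy₀
  let b := Module.finBasisOfFinrankEq ℂ _ (hdim _ hv₀)
  choose W hWE hWb using fun j : Fin 2 => hgen _ hv₀ (b j) (b j).2
  obtain ⟨G, hG0, hG⟩ := exists_eval_linear_combination_eq_zero h0 hT 2
    (fun j i => dehomogenize (W j i))
  refine ⟨G, hG0, ?_⟩
  have hli : LinearIndependent ℂ ![evalField (Fin.cons 1 y₀ : Fin 4 → ℂ) (W 0),
      evalField (Fin.cons 1 y₀ : Fin 4 → ℂ) (W 1)] := by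
    have h1 := b.linearIndependent.map' (E (Fin.cons 1 y₀)).subtype (by simp)
    have h2 : ![evalField (Fin.cons 1 y₀ : Fin 4 → ℂ) (W 0),
        evalField (Fin.cons 1 y₀ : Fin 4 → ℂ) (W 1)] = (E (Fin.cons 1 y₀)).subtype ∘ b := by
      ext j i
      fin_cases j <;> simp [hWb]
    rw [h2]
    exact h1
  obtain ⟨k, l, hkl⟩ : ∃ k l, eval (Fin.cons 1 y₀ : Fin 4 → ℂ)
      (W 0 k * W 1 l - W 0 l * W 1 k) ≠ 0 := by
    by_contra! hcon
    rw [LinearIndependent.pair_iff] at hli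
    have hz : ∀ l, evalField (Fin.cons 1 y₀ : Fin 4 → ℂ) (W 0) l = 0 := by
      intro l
      have := hli (evalField (Fin.cons 1 y₀ : Fin 4 → ℂ) (W 1) l)
        (-evalField (Fin.cons 1 y₀ : Fin 4 → ℂ) (W 0) l) (by
          ext k
          have := hcon k l
          simp only [map_sub, map_mul] at this
          simp only [evalField, Pi.add_apply, Pi.smul_apply, smul_eq_mul, Pi.zero_apply]
          linear_combination this)
      simpa using this.2
    have := hli 1 0 (by ext l; simp [hz])
    simp at this
  -- Where this minor is nonzero the two fields span `E`, and the equation `G` applies. It is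
  -- nonzero at the base point, so primality extends the vanishing to the whole chart.
  set D := W 0 k * W 1 l - W 0 l * W 1 k with hD
  have hchart : ∀ V : Fin 4 → MvPolynomial (Fin 4) ℂ, (∀ u ∈ cone X, evalField u V ∈ E u) →
      dehomogenize (aeval V G) ∈ vanishingIdeal ℂ (chart X) := by
    intro V hV
    have hmul : dehomogenize (aeval V G) * dehomogenize D ∈ vanishingIdeal ℂ (chart X) := by
      rw [mem_vanishingIdeal_iff_eval]
      intro y hy
      have hv : (Fin.cons 1 y : Fin 4 → ℂ) ∈ cone X := hy
      rw [map_mul, eval_dehomogenize, eval_dehomogenize]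
      by_cases hDv : eval (Fin.cons 1 y : Fin 4 → ℂ) D = 0
      · simp [hDv]
      suffices h : eval (Fin.cons 1 y : Fin 4 → ℂ) (aeval V G) = 0 by rw [h, zero_mul]
      set v : Fin 4 → ℂ := Fin.cons 1 y with hvdef
      have hli' : LinearIndependent ℂ ![evalField v (W 0), evalField v (W 1)] := by
        rw [LinearIndependent.pair_iff]
        intro s t hst
        have hk := congrFun hst k
        have hl := congrFun hst l
        simp only [Pi.add_apply, Pi.smul_apply, smul_eq_mul, Pi.zero_apply, evalField] at hk hl
        simp only [hD, map_sub, map_mul] at hDv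
        constructor
        · apply (mul_eq_zero.1 (?_ : s * _ = 0)).resolve_right hDv
          linear_combination eval v (W 1 l) * hk - eval v (W 1 k) * hl
        · apply (mul_eq_zero.1 (?_ : t * _ = 0)).resolve_right hDv
          linear_combination eval v (W 0 k) * hl - eval v (W 0 l) * hk
      have hspan : Submodule.span ℂ (Set.range ![evalField v (W 0), evalField v (W 1)]) = E v := by
        apply Submodule.eq_of_le_of_finrank_eq
        · rw [Submodule.span_le]
          rintro _ ⟨j, rfl⟩
          fin_cases j
          · exact hWE 0 v hv
          · exact hWE 1 v hv
        · rw [finrank_span_eq_card hli', hdim v hv]; simp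
      have hmem := hV v hv
      rw [← hspan, Submodule.mem_span_range_iff_exists_fun] at hmem
      obtain ⟨s, hs⟩ := hmem
      rw [← eval_evalField, ← hs]
      have heq : ∑ j, s j • ![evalField v (W 0), evalField v (W 1)] j =
          fun i => ∑ j, s j * eval y (dehomogenize (W j i)) := by
        ext i
        simp [Fin.sum_univ_two, evalField, eval_dehomogenize, hvdef]
      rw [heq]
      exact hG y hy s
    refine (hprime.mem_or_mem hmul).resolve_right fun hDmem => hkl ?_
    have := mem_vanishingIdeal_iff_eval.1 hDmem y₀ hy₀
    rwa [eval_dehomogenize] at this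
  intro v hv w hw
  obtain ⟨V, hV, rfl⟩ := hgen v hv w hw
  have hmem : aeval V G ∈ idealOf X := by
    refine mem_idealOf_of_mul_mem h0 fun u hu hu0 => ?_
    rw [eval_X] at hu0
    obtain ⟨y, hy, huy⟩ := exists_chart_of_mem_cone hu hu0
    have hu1 : (Fin.cons 1 y : Fin 4 → ℂ) ∈ cone X := hy
    rw [← eval_evalField]
    -- `G` need not be homogeneous, so the value of `V` at `u` must not be rescaled. It is a vector
    -- of `E` at the chart point under `u`, and a second field `V'` is drawn through it there.
    have h1 := hV u hu
    rw [huy, hsmul _ _ hu0] at h1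
    obtain ⟨V', hV', hV'u⟩ := hgen _ hu1 _ h1
    have h2 := mem_vanishingIdeal_iff_eval.1 (hchart V' hV') y hy
    rw [eval_dehomogenize, ← eval_evalField, hV'u] at h2
    rwa [huy]
  rw [eval_evalField]
  exact mem_idealOf.1 hmem v hv

theorem exists_conormal_field {v h : Fin 4 → ℂ} (hh : h ∈ conormalAt X v) :
    ∃ W : Fin 4 → MvPolynomial (Fin 4) ℂ,
      (∀ u, evalField u W ∈ conormalAt X u) ∧ evalField v W = h := by
  obtain ⟨f, hf, rfl⟩ := mem_conormalAt.1 hh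
  exact ⟨fun i => pderiv i f, fun u => mem_conormalAt.2 ⟨f, hf, rfl⟩, rfl⟩

/-- The vector whose `i`-th coordinate is zero and whose remaining coordinates are those of the
cross product of `a` and `b` with the `i`-th coordinate removed. -/
def crossAt {R : Type*} [CommRing R] (i : Fin 4) (a b : Fin 4 → R) : Fin 4 → R :=
  i.insertNth 0 ((fun k => a (i.succAbove k)) ⨯₃ fun k => b (i.succAbove k))

theorem sum_mul_crossAt {R : Type*} [CommRing R] (i : Fin 4) (a b c : Fin 4 → R) :
    ∑ j, c j * crossAt i a b j =
      (fun k => c (i.succAbove k)) ⬝ᵥ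
        ((fun k => a (i.succAbove k)) ⨯₃ fun k => b (i.succAbove k)) := by
  rw [Fin.sum_univ_succAbove _ i]
  simp [crossAt, dotProduct]

theorem evalField_crossAt {σ : Type*} (i : Fin 4) (a b : Fin 4 → MvPolynomial σ ℂ) (v : σ → ℂ) :
    evalField v (crossAt i a b) = crossAt i (evalField v a) (evalField v b) := by
  ext j
  refine Fin.succAboveCases i ?_ (fun k => ?_) j
  · simp [evalField, crossAt]
  · simp only [evalField, crossAt, Fin.insertNth_apply_succAbove, cross_apply]
    fin_cases k <;> simp

theorem exists_smul_cross {a b w : Fin 3 → ℂ} (hab : LinearIndependent ℂ ![a, b])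
    (ha : a ⬝ᵥ w = 0) (hb : b ⬝ᵥ w = 0) : ∃ t : ℂ, w = t • (a ⨯₃ b) := by
  have h1 : (a ⨯₃ b) ≠ 0 := crossProduct_ne_zero_iff_linearIndependent.2 hab
  have h2 : (a ⨯₃ b) ⨯₃ w = 0 := by
    rw [cross_cross_eq_smul_sub_smul, ha, hb]
    simp
  have h3 : ¬ LinearIndependent ℂ ![a ⨯₃ b, w] := fun h =>
    crossProduct_ne_zero_iff_linearIndependent.2 h h2
  rw [LinearIndependent.pair_iff' h1] at h3
  push Not at h3
  obtain ⟨t, ht⟩ := h3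
  exact ⟨t, ht.symm⟩

theorem exists_linearIndependent_gradients {v : Fin 4 → ℂ}
    (h : Module.finrank ℂ (tangentAt X v) = 2) : ∃ f ∈ idealOf X, ∃ g ∈ idealOf X,
      LinearIndependent ℂ ![fun i => eval v (pderiv i f), fun i => eval v (pderiv i g)] := by
  let b := Module.finBasisOfFinrankEq ℂ _ (finrank_conormalAt h)
  obtain ⟨f, hf, hfb⟩ := mem_conormalAt.1 (b 0).2
  obtain ⟨g, hg, hgb⟩ := mem_conormalAt.1 (b 1).2
  refine ⟨f, hf, g, hg, ?_⟩
  have h1 := b.linearIndependent.map' (conormalAt X v).subtype (by simp)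
  have h2 : ![fun i => eval v (pderiv i f), fun i => eval v (pderiv i g)] =
      (conormalAt X v).subtype ∘ b := by
    ext j i
    fin_cases j <;> simp [← hfb, ← hgb]
  rw [h2]
  exact h1

/-- When `v i ≠ 0`, the tangent space is spanned by `v` and by one vector with `i`-th entry zero.
The latter is the cross product of two independent gradients with their `i`-th entries removed. Both
generators are polynomial in the point, and the cross product is tangent all along the curve because
any three gradients in a two-dimensional conormal space are dependent. -/
theorem exists_tangent_field (hT : ∀ v ∈ cone X, Module.finrank ℂ (tangentAt X v) = 2)
    {v w : Fin 4 → ℂ} (hv : v ∈ cone X) (hw : w ∈ tangentAt X v) :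
    ∃ W : Fin 4 → MvPolynomial (Fin 4) ℂ,
      (∀ u ∈ cone X, evalField u W ∈ tangentAt X u) ∧ evalField v W = w := by
  obtain ⟨i, hi⟩ := Function.ne_iff.1 (ne_zero_of_mem_cone hv)
  rw [Pi.zero_apply] at hi
  obtain ⟨f, hf, g, hg, hfg⟩ := exists_linearIndependent_gradients (hT v hv)
  set a : Fin 4 → ℂ := fun j => eval v (pderiv j f)
  set b : Fin 4 → ℂ := fun j => eval v (pderiv j g)
  have hav : ∑ j, a j * v j = 0 := self_mem_tangentAt hv f hf
  have hbv : ∑ j, b j * v j = 0 := self_mem_tangentAt hv g hg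
  have haw : ∑ j, a j * w j = 0 := hw f hf
  have hbw : ∑ j, b j * w j = 0 := hw g hg
  rw [Fin.sum_univ_succAbove _ i] at hav hbv haw hbw
  -- Euler's relation recovers the removed entry from the others, so independence survives the
  -- removal.
  have hli : LinearIndependent ℂ ![fun k => a (i.succAbove k), fun k => b (i.succAbove k)] := by
    rw [LinearIndependent.pair_iff] at hfg ⊢
    intro s t hst
    have hk : ∀ k, s * a (i.succAbove k) + t * b (i.succAbove k) = 0 := fun k => by
      simpa using congrFun hst k
    apply hfg
    ext j
    refine Fin.succAboveCases i ?_ (fun k => ?_) j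
    · have h1 : ∑ k, (s * a (i.succAbove k) + t * b (i.succAbove k)) * v (i.succAbove k) = 0 :=
        Finset.sum_eq_zero fun k _ => by rw [hk, zero_mul]
      simp only [add_mul, mul_assoc, Finset.sum_add_distrib, ← Finset.mul_sum] at h1
      refine (mul_eq_zero.1 (?_ : _ * v i = 0)).resolve_right hi
      simp only [Pi.add_apply, Pi.smul_apply, smul_eq_mul]
      linear_combination s * hav + t * hbv - h1
    · simpa using hk k
  have hz : ∀ c : Fin 4 → ℂ, c i * v i + ∑ k, c (i.succAbove k) * v (i.succAbove k) = 0 →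
      c i * w i + ∑ k, c (i.succAbove k) * w (i.succAbove k) = 0 →
      (fun k => c (i.succAbove k)) ⬝ᵥ
        (fun k => w (i.succAbove k) - w i / v i * v (i.succAbove k)) = 0 := by
    intro c h1 h2
    simp only [dotProduct, mul_sub, Finset.sum_sub_distrib]
    have h3 : ∑ k, c (i.succAbove k) * (w i / v i * v (i.succAbove k)) =
        w i / v i * ∑ k, c (i.succAbove k) * v (i.succAbove k) := by
      rw [Finset.mul_sum]
      exact Finset.sum_congr rfl fun k _ => by ring
    rw [h3]
    have h4 : w i / v i * v i = w i := div_mul_cancel₀ _ hi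
    linear_combination h2 - (w i / v i) * h1 + c i * h4
  obtain ⟨t, ht⟩ := exists_smul_cross hli (hz a hav haw) (hz b hbv hbw)
  let τ : Fin 4 → MvPolynomial (Fin 4) ℂ := crossAt i (fun j => pderiv j f) (fun j => pderiv j g)
  have hev : ∀ u, evalField u (fun j => C (w i / v i) * MvPolynomial.X j + C t * τ j) =
      (w i / v i) • u + t • evalField u τ := by
    intro u
    ext j
    simp [evalField]
  refine ⟨fun j => C (w i / v i) * MvPolynomial.X j + C t * τ j, fun u hu => ?_, ?_⟩
  · rw [hev]
    refine Submodule.add_mem _ (Submodule.smul_mem _ _ (self_mem_tangentAt hu))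
      (Submodule.smul_mem _ _ ?_)
    rw [evalField_crossAt]
    intro k hk
    rw [sum_mul_crossAt, triple_product_eq_det]
    apply Matrix.exists_vecMul_eq_zero_iff.1
    let z : Fin 3 → conormalAt X u := ![⟨_, mem_conormalAt.2 ⟨k, hk, rfl⟩⟩,
      ⟨_, mem_conormalAt.2 ⟨f, hf, rfl⟩⟩, ⟨_, mem_conormalAt.2 ⟨g, hg, rfl⟩⟩]
    have hz3 : ¬ LinearIndependent ℂ z := by
      intro h
      have := h.fintype_card_le_finrank
      rw [finrank_conormalAt (hT u hu)] at this
      simp at this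
    rw [Fintype.not_linearIndependent_iff] at hz3
    obtain ⟨c, hc, m, hm⟩ := hz3
    refine ⟨c, fun h => hm (by rw [h]; rfl), ?_⟩
    ext j
    have h1 := congrFun (congrArg Subtype.val hc) (i.succAbove j)
    simpa [z, Fin.sum_univ_three, Matrix.vecMul, dotProduct, evalField] using h1
  · rw [hev, evalField_crossAt]
    ext j
    refine Fin.succAboveCases i ?_ (fun k => ?_) j
    · simp [crossAt, hi]
    · have := congrFun ht k
      simp only [Pi.smul_apply, smul_eq_mul] at this
      simp only [Pi.add_apply, Pi.smul_apply, smul_eq_mul, crossAt, Fin.insertNth_apply_succAbove,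
        evalField]
      linear_combination -this

/-- The tangent developable is at most a surface; centres of projection will be taken off it. -/
theorem exists_tangent_developable [(idealOf X).IsPrime] (h0 : MvPolynomial.X 0 ∉ idealOf X)
    (hT : ∀ v ∈ cone X, Module.finrank ℂ (tangentAt X v) = 2) :
    ∃ G : MvPolynomial (Fin 4) ℂ, G ≠ 0 ∧ ∀ v ∈ cone X, ∀ w ∈ tangentAt X v, eval w G = 0 :=
  exists_forall_eval_eq_zero h0 hT (tangentAt X) (fun _ _ hc => tangentAt_smul hc) hT
    fun _ hv _ hw => exists_tangent_field hT hv hw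

theorem exists_conormal_equation [(idealOf X).IsPrime] (h0 : MvPolynomial.X 0 ∉ idealOf X)
    (hT : ∀ v ∈ cone X, Module.finrank ℂ (tangentAt X v) = 2) :
    ∃ G : MvPolynomial (Fin 4) ℂ, G ≠ 0 ∧ ∀ v ∈ cone X, ∀ w ∈ conormalAt X v, eval w G = 0 :=
  exists_forall_eval_eq_zero h0 hT (conormalAt X) (fun _ _ hc => conormalAt_smul hc)
    (fun v hv => finrank_conormalAt (hT v hv)) fun _ _ _ hw =>
      let ⟨W, hW, h⟩ := exists_conormal_field hw
      ⟨W, fun u _ => hW u, h⟩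

end SpaceCurve

/-! ### Linear factors of a polynomial -/

section Linear

variable {m : ℕ}

/-- The linear form with coefficient vector `q`. -/
noncomputable def linearForm (q : Fin m → ℂ) : MvPolynomial (Fin m) ℂ :=
  sumSMulX (Finsupp.equivFunOnFinite.symm q)

theorem coeff_linearForm (q : Fin m → ℂ) (i : Fin m) :
    (linearForm q).coeff (Finsupp.single i 1) = q i := by
  simp [linearForm, coeff_sumSMulX]

theorem eval_linearForm (q h : Fin m → ℂ) : eval h (linearForm q) = q ⬝ᵥ h := by
  simp [linearForm, sumSMulX, Finsupp.linearCombination_apply, dotProduct, Finsupp.sum_fintype,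
    smul_eval]

theorem linearForm_prime {q : Fin m → ℂ} (hq : q ≠ 0) : Prime (linearForm q) := by
  obtain ⟨i, hi⟩ := Function.ne_iff.1 hq
  rw [Pi.zero_apply] at hi
  refine Irreducible.prime (irreducible_sumSMulX _ ⟨i, by simpa using hi⟩ fun r hr => ?_)
  have h1 := hr i
  rw [isUnit_iff_ne_zero]
  rintro rfl
  exact hi (by simpa using h1)

theorem linearForm_dvd {q : Fin m → ℂ} (hq : q ≠ 0) {r : MvPolynomial (Fin m) ℂ}
    (h : ∀ x, q ⬝ᵥ x = 0 → eval x r = 0) : linearForm q ∣ r := by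
  have hmem : r ∈ vanishingIdeal ℂ (zeroLocus ℂ (Ideal.span {linearForm q})) := by
    rw [mem_vanishingIdeal_iff_eval]
    intro x hx
    apply h
    have := hx _ (Ideal.mem_span_singleton_self _)
    rw [← eval_linearForm]
    simpa using this
  have hprime : (Ideal.span {linearForm q}).IsPrime :=
    (Ideal.span_singleton_prime (linearForm_prime hq).ne_zero).2 (linearForm_prime hq)
  rwa [vanishingIdeal_zeroLocus_eq_radical, hprime.radical, Ideal.mem_span_singleton] at hmem

/-- A nonzero polynomial vanishes on finitely many linear hyperplanes only. -/
theorem exists_finite_hyperplanes {r : MvPolynomial (Fin m) ℂ} (hr : r ≠ 0)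
    (S : Set (Fin m → ℂ)) (hS : ∀ q ∈ S, q ≠ 0 ∧ ∀ x, q ⬝ᵥ x = 0 → eval x r = 0) :
    ∃ F : Set (Fin m → ℂ), F.Finite ∧ F ⊆ S ∧ ∀ q ∈ S, ∃ q' ∈ F, ∃ u : ℂ, q' = u • q := by
  classical
  let φ : (Fin m → ℂ) → Associates (MvPolynomial (Fin m) ℂ) := fun q => Associates.mk (linearForm q)
  -- Unique factorization: the linear forms dividing `r` fall into finitely many classes of
  -- associates.
  have hfin : (φ '' S).Finite := by
    let := UniqueFactorizationMonoid.fintypeSubtypeDvd (Associates.mk r)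
      (Associates.mk_ne_zero.2 hr)
    have hdvd : Finite {a // a ∣ Associates.mk r} := Finite.of_fintype _
    refine Set.Finite.subset (s := {a | a ∣ Associates.mk r}) (Set.finite_coe_iff.1 hdvd) ?_
    rintro _ ⟨q, hq, rfl⟩
    exact Associates.mk_dvd_mk.2 (linearForm_dvd (hS q hq).1 (hS q hq).2)
  obtain ⟨F, hFS, hF, hFeq⟩ : ∃ F ⊆ S, F.Finite ∧ φ '' F = φ '' S := by
    choose! g hg using fun a (ha : a ∈ φ '' S) => ha
    refine ⟨g '' (φ '' S), ?_, hfin.image g, ?_⟩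
    · rintro _ ⟨a, ha, rfl⟩
      exact (hg a ha).1
    · apply le_antisymm
      · rintro _ ⟨_, ⟨a, ha, rfl⟩, rfl⟩
        exact ⟨_, (hg a ha).1, rfl⟩
      · rintro a ha
        exact ⟨g a, ⟨a, ha, rfl⟩, (hg a ha).2⟩
  refine ⟨F, hF, hFS, fun q hq => ?_⟩
  obtain ⟨q', hq', h⟩ : φ q ∈ φ '' F := hFeq ▸ ⟨q, hq, rfl⟩
  obtain ⟨u, hu⟩ := (Associates.mk_eq_mk_iff_associated.1 h).symm
  obtain ⟨c, hc, hcu⟩ := (MvPolynomial.isUnit_iff_eq_C_of_isReduced).1 u.isUnit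
  refine ⟨q', hq', c, ?_⟩
  ext i
  rw [← coeff_linearForm q', ← hu, hcu, mul_comm, coeff_C_mul, coeff_linearForm]
  rfl

end Linear

/-! ### The dual surface: irreducibility and a dominant coordinate projection -/

section SpaceCurve

variable {X : Set (PP 3)}

/-- The vectors that represent planes tangent to `X`, together with the zero vector. -/
def dualCone (X : Set (PP 3)) : Set (Fin 4 → ℂ) := {h | ∃ v ∈ cone X, h ∈ conormalAt X v}

/-- Linear spaces over an irreducible base have irreducible total space. Two conormal fields can be
evaluated at a common general point; the line joining the two values stays in one conormal space,
and on a line a product vanishes only if a factor does. -/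
theorem dualCone_isPrime [hp : (idealOf X).IsPrime] (hne : (cone X).Nonempty) :
    (vanishingIdeal ℂ (dualCone X)).IsPrime := by
  refine ⟨fun h => ?_, fun {f g} hfg => ?_⟩
  · obtain ⟨v, hv⟩ := hne
    have h1 : (1 : MvPolynomial (Fin 4) ℂ) ∈ vanishingIdeal ℂ (dualCone X) :=
      h ▸ Submodule.mem_top
    simpa using mem_vanishingIdeal_iff_eval.1 h1 0 ⟨v, hv, Submodule.zero_mem _⟩
  · rw [mem_vanishingIdeal_iff_eval] at hfg
    by_contra! hcon
    simp only [mem_vanishingIdeal_iff_eval] at hcon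
    push Not at hcon
    obtain ⟨⟨h₁, ⟨v₁, hv₁, hh₁⟩, hf⟩, ⟨h₂, ⟨v₂, hv₂, hh₂⟩, hg⟩⟩ := hcon
    obtain ⟨W₁, hW₁, rfl⟩ := exists_conormal_field hh₁
    obtain ⟨W₂, hW₂, rfl⟩ := exists_conormal_field hh₂
    rw [eval_evalField] at hf hg
    have hmul : aeval W₁ f * aeval W₂ g ∉ idealOf X := fun hmem => by
      rcases hp.mem_or_mem hmem with h | h
      · exact hf (mem_idealOf.1 h _ hv₁)
      · exact hg (mem_idealOf.1 h _ hv₂)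
    rw [mem_idealOf] at hmul
    push Not at hmul
    obtain ⟨v, hv, hne0⟩ := hmul
    rw [map_mul, ← eval_evalField, ← eval_evalField] at hne0
    have hzero : restrictLine (evalField v W₁) (evalField v W₂ - evalField v W₁) f *
        restrictLine (evalField v W₁) (evalField v W₂ - evalField v W₁) g = 0 := by
      refine Polynomial.funext fun s => ?_
      rw [Polynomial.eval_mul, eval_restrictLine, eval_restrictLine, ← map_mul,
        Polynomial.eval_zero]
      refine hfg _ ⟨v, hv, ?_⟩
      exact Submodule.add_mem _ (hW₁ v) (Submodule.smul_mem _ _ (Submodule.sub_mem _ (hW₂ v) (hW₁ v)))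
    apply hne0
    rcases mul_eq_zero.1 hzero with h | h
    · have := eval_restrictLine (evalField v W₁) (evalField v W₂ - evalField v W₁) f 0
      rw [h] at this
      simp only [Polynomial.eval_zero, zero_smul, add_zero] at this
      rw [← this, zero_mul]
    · have := eval_restrictLine (evalField v W₁) (evalField v W₂ - evalField v W₁) g 1
      rw [h] at this
      simp only [Polynomial.eval_zero, one_smul, add_sub_cancel] at this
      rw [← this, mul_zero]

/-- Being tangent in the direction `q` is a closed condition on the point, and an irreducible curve
is not covered by finitely many proper closed subsets together with the zeros of `g`. -/
theorem forall_mem_tangentAt_of_finite [hp : (idealOf X).IsPrime] {g : MvPolynomial (Fin 4) ℂ}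
    (hg : g ∉ idealOf X) {F : Set (Fin 4 → ℂ)} (hF : F.Finite)
    (h : ∀ v ∈ cone X, eval v g ≠ 0 → ∃ q ∈ F, q ∈ tangentAt X v) :
    ∃ q ∈ F, ∀ v ∈ cone X, q ∈ tangentAt X v := by
  classical
  by_contra! hcon
  have hq : ∀ q ∈ F, ∃ f ∈ idealOf X, ∑ i, pderiv i f * C (q i) ∉ idealOf X := by
    intro q hqF
    obtain ⟨v, hv, hqv⟩ := hcon q hqF
    rw [mem_tangentAt] at hqv
    push Not at hqv
    obtain ⟨f, hf, hne⟩ := hqv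
    refine ⟨f, hf, fun hmem => hne ?_⟩
    simpa using mem_idealOf.1 hmem v hv
  choose! f hf hfn using hq
  have hprod : (∏ q ∈ hF.toFinset, ∑ i, pderiv i (f q) * C (q i)) * g ∉ idealOf X := by
    intro hmem
    have h1 := (hp.mem_or_mem hmem).resolve_right hg
    obtain ⟨q, hq, hmem'⟩ := (hp.prod_mem_iff).1 h1
    exact hfn q (hF.mem_toFinset.1 hq) hmem'
  rw [mem_idealOf] at hprod
  push Not at hprod
  obtain ⟨v, hv, hne⟩ := hprod
  rw [map_mul] at hne
  obtain ⟨q, hqF, hqv⟩ := h v hv (right_ne_zero_of_mul hne)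
  apply left_ne_zero_of_mul hne
  rw [map_prod]
  refine Finset.prod_eq_zero (hF.mem_toFinset.2 hqF) ?_
  simpa using hqv (f q) (hf q hqF)

/-- For `v i ≠ 0` the tangent line at `v` meets the plane `xᵢ = 0` in one point `q`, and forgetting
the `i`-th entry maps the conormal space onto the orthogonal of `q`. Hence `r` is divisible by the
linear form `q`. Only finitely many such `q` exist up to scaling, so one of them lies on every
tangent line. -/
theorem exists_common_tangent_vector [hp : (idealOf X).IsPrime]
    (hT : ∀ v ∈ cone X, Module.finrank ℂ (tangentAt X v) = 2) (i : Fin 4)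
    (hi : MvPolynomial.X i ∉ idealOf X) {r : MvPolynomial (Fin 3) ℂ} (hr : r ≠ 0)
    (hmem : rename i.succAbove r ∈ vanishingIdeal ℂ (dualCone X)) :
    ∃ q : Fin 4 → ℂ, q ≠ 0 ∧ q i = 0 ∧ ∀ v ∈ cone X, q ∈ tangentAt X v := by
  classical
  let S : Set (Fin 3 → ℂ) := {q | q ≠ 0 ∧ ∃ v ∈ cone X, v i ≠ 0 ∧
    (i.insertNth 0 q : Fin 4 → ℂ) ∈ tangentAt X v}
  have hS : ∀ q ∈ S, q ≠ 0 ∧ ∀ x, q ⬝ᵥ x = 0 → eval x r = 0 := by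
    rintro q ⟨hq, v, hv, hvi, hqv⟩
    refine ⟨hq, fun x hx => ?_⟩
    have hli : LinearIndependent ℂ ![v, (i.insertNth 0 q : Fin 4 → ℂ)] := by
      rw [LinearIndependent.pair_iff]
      intro s t hst
      have hs : s = 0 := by
        have := congrFun hst i
        simpa [hvi] using this
      refine ⟨hs, ?_⟩
      obtain ⟨k, hk⟩ := Function.ne_iff.1 hq
      have := congrFun hst (i.succAbove k)
      simpa [hs, show q k ≠ 0 from hk] using this
    have hspan : Submodule.span ℂ (Set.range ![v, (i.insertNth 0 q : Fin 4 → ℂ)]) =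
        tangentAt X v := by
      apply Submodule.eq_of_le_of_finrank_eq
      · rw [Submodule.span_le]
        rintro _ ⟨j, rfl⟩
        fin_cases j
        · exact self_mem_tangentAt hv
        · exact hqv
      · rw [finrank_span_eq_card hli, hT v hv]; simp
    let h : Fin 4 → ℂ := i.insertNth (-(∑ k, x k * v (i.succAbove k)) / v i) x
    have hh : h ∈ conormalAt X v := by
      rw [mem_conormalAt_iff_forall]
      intro w hw
      rw [← hspan, Submodule.mem_span_range_iff_exists_fun] at hw
      obtain ⟨s, rfl⟩ := hw
      have h1 : h ⬝ᵥ v = 0 := by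
        rw [dotProduct, Fin.sum_univ_succAbove _ i]
        simp [h, hvi]
      have h2 : h ⬝ᵥ (i.insertNth 0 q : Fin 4 → ℂ) = 0 := by
        rw [dotProduct, Fin.sum_univ_succAbove _ i]
        rw [dotProduct_comm] at hx
        simpa [h, dotProduct] using hx
      simp [Fin.sum_univ_two, dotProduct_add, dotProduct_smul, h1, h2]
    have h3 := mem_vanishingIdeal_iff_eval.1 hmem h ⟨v, hv, hh⟩
    rw [eval_rename] at h3
    have hx : h ∘ i.succAbove = x := by
      ext k
      simp [h]
    rwa [hx] at h3
  obtain ⟨F, hF, hFS, hF'⟩ := exists_finite_hyperplanes hr S hS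
  obtain ⟨q, hqF, hq⟩ := forall_mem_tangentAt_of_finite hi
    (hF.image fun q => (i.insertNth 0 q : Fin 4 → ℂ)) (by
      intro v hv hvi
      rw [eval_X] at hvi
      obtain ⟨w, hw, hwi, hw0⟩ : ∃ w ∈ tangentAt X v, w i = 0 ∧ w ≠ 0 := by
        obtain ⟨z, hz, hzv⟩ : ∃ z ∈ tangentAt X v, z ∉ Submodule.span ℂ {v} := by
          by_contra! hle
          have h3 := Submodule.finrank_mono (show tangentAt X v ≤ Submodule.span ℂ {v} from hle)
          rw [hT v hv] at h3
          have : 2 ≤ 1 := h3.trans ((finrank_span_le_card ({v} : Set (Fin 4 → ℂ))).trans (by simp))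
          omega
        refine ⟨z - (z i / v i) • v, Submodule.sub_mem _ hz
          (Submodule.smul_mem _ _ (self_mem_tangentAt hv)), by simp [hvi], fun h0 => hzv ?_⟩
        rw [sub_eq_zero.1 h0]
        exact Submodule.smul_mem _ _ (Submodule.mem_span_singleton_self v)
      have hwq : w = i.insertNth 0 fun k => w (i.succAbove k) := by
        ext j
        refine Fin.succAboveCases i ?_ (fun k => ?_) j <;> simp [hwi]
      have hmemS : (fun k => w (i.succAbove k)) ∈ S := by
        refine ⟨fun h0 => hw0 ?_, v, hv, hvi, ?_⟩
        · rw [hwq, h0]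
          ext j
          refine Fin.succAboveCases i ?_ (fun k => ?_) j <;> simp
        · rwa [← hwq]
      obtain ⟨q', hq', u, hu⟩ := hF' _ hmemS
      refine ⟨_, ⟨q', hq', rfl⟩, ?_⟩
      have : (i.insertNth 0 q' : Fin 4 → ℂ) = u • w := by
        ext j
        refine Fin.succAboveCases i ?_ (fun k => ?_) j <;> simp [hwi, hu]
      change (i.insertNth 0 q' : Fin 4 → ℂ) ∈ tangentAt X v
      rw [this]
      exact Submodule.smul_mem _ _ hw)
  obtain ⟨q, hqF', rfl⟩ := hqF
  refine ⟨_, fun h0 => (hFS hqF').1 ?_, by simp, hq⟩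
  ext k
  have := congrFun h0 (i.succAbove k)
  simpa using this

/-- Some coordinate projection of the dual surface is dominant. -/
theorem exists_dominant_projection [hp : (idealOf X).IsPrime] (hne : (cone X).Nonempty)
    (hT : ∀ v ∈ cone X, Module.finrank ℂ (tangentAt X v) = 2)
    (hplane : ∀ h : Fin 4 → ℂ, h ≠ 0 → ∃ v ∈ cone X, h ⬝ᵥ v ≠ 0) :
    ∃ i : Fin 4, ∀ r : MvPolynomial (Fin 3) ℂ,
      rename i.succAbove r ∈ vanishingIdeal ℂ (dualCone X) → r = 0 := by
  by_contra! hcon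
  have hX : ∀ i : Fin 4, MvPolynomial.X i ∉ idealOf X := by
    intro i hi
    obtain ⟨v, hv, hne⟩ := hplane (Pi.single i 1) (by simp)
    apply hne
    simpa using mem_idealOf.1 hi v hv
  have key : ∀ i : Fin 4, ∃ q : Fin 4 → ℂ, q ≠ 0 ∧ q i = 0 ∧ ∀ v ∈ cone X, q ∈ tangentAt X v := by
    intro i
    obtain ⟨r, hmem, hr⟩ := hcon i
    exact exists_common_tangent_vector hT i (hX i) hr hmem
  -- A second common vector is chosen with `j`-th entry zero, where `q j ≠ 0`, so the two are
  -- independent. They span every tangent space; the curve then lies in one line, against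
  -- non-planarity.
  obtain ⟨q, hq, -, hqT⟩ := key 0
  obtain ⟨j, hj⟩ := Function.ne_iff.1 hq
  rw [Pi.zero_apply] at hj
  obtain ⟨q', hq', hq'j, hqT'⟩ := key j
  have hli : LinearIndependent ℂ ![q, q'] := by
    rw [LinearIndependent.pair_iff]
    intro s t hst
    have hs : s = 0 := by
      have := congrFun hst j
      simpa [hj, hq'j] using this
    refine ⟨hs, ?_⟩
    obtain ⟨k, hk⟩ := Function.ne_iff.1 hq'
    have := congrFun hst k
    simpa [hs, show q' k ≠ 0 from hk] using this
  have hspan : ∀ v ∈ cone X, Submodule.span ℂ (Set.range ![q, q']) = tangentAt X v := by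
    intro v hv
    apply Submodule.eq_of_le_of_finrank_eq
    · rw [Submodule.span_le]
      rintro _ ⟨j, rfl⟩
      fin_cases j
      · exact hqT v hv
      · exact hqT' v hv
    · rw [finrank_span_eq_card hli, hT v hv]; simp
  obtain ⟨v, hv⟩ := hne
  have : conormalAt X v ≠ ⊥ := by
    intro hbot
    have := finrank_conormalAt (hT v hv)
    rw [hbot] at this
    simp at this
  obtain ⟨h, hh, hh0⟩ := Submodule.exists_mem_ne_zero_of_ne_bot this
  obtain ⟨u, hu, hhu⟩ := hplane h hh0
  apply hhu
  refine mem_conormalAt_iff_forall.1 hh u ?_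
  rw [← hspan v hv, hspan u hu]
  exact self_mem_tangentAt hu

end SpaceCurve

/-! ### Equation and closedness of the dual surface -/

section

/-- A point outside a closed set is separated from it by a homogeneous polynomial. -/
theorem exists_homogeneous_of_notMem_closure {n : ℕ} {S : Set (PP n)} {P : PP n}
    (hP : P ∉ closure S) : ∃ (f : MvPolynomial (Fin (n + 1)) ℂ) (d : ℕ), f.IsHomogeneous d ∧
      eval P.rep f ≠ 0 ∧ ∀ Q ∈ S, eval Q.rep f = 0 := by
  have hbasis : TopologicalSpace.IsTopologicalBasis
      {U : Set (PP n) | ∃ (f : MvPolynomial (Fin (n + 1)) ℂ) (d : ℕ), f.IsHomogeneous d ∧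
        U = (hypersurface f)ᶜ} := by
    refine ⟨?_, ?_, rfl⟩
    · rintro _ ⟨f, d, hf, rfl⟩ _ ⟨g, e, hg, rfl⟩ Q hQ
      refine ⟨_, ⟨f * g, d + e, hf.mul hg, rfl⟩, ?_, ?_⟩
      · simp only [hypersurface, Set.mem_compl_iff, Set.mem_ofPred_eq, map_mul]
        exact mul_ne_zero hQ.1 hQ.2
      · intro R hR
        simp only [hypersurface, Set.mem_compl_iff, Set.mem_ofPred_eq, map_mul] at hR
        exact ⟨left_ne_zero_of_mul hR, right_ne_zero_of_mul hR⟩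
    · refine Set.eq_univ_of_forall fun Q => ⟨_, ⟨1, 0, isHomogeneous_one _ _, rfl⟩, ?_⟩
      simp [hypersurface]
  have hopen : IsOpen (closure S)ᶜ := isClosed_closure.isOpen_compl
  obtain ⟨_, ⟨f, d, hf, rfl⟩, hPf, hfS⟩ := hbasis.exists_subset_of_mem_open hP hopen
  refine ⟨f, d, hf, hPf, fun Q hQ => ?_⟩
  by_contra hne
  exact hfS hne (subset_closure hQ)

theorem exists_mem_idealOf_eval_ne_zero {n : ℕ} {X : Set (PP n)} (hcl : IsClosed X)
    {x : Fin (n + 1) → ℂ} (hx : x ≠ 0) (hxX : x ∉ cone X) : ∃ f ∈ idealOf X, eval x f ≠ 0 := by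
  have hP : Projectivization.mk ℂ x hx ∉ closure X := by
    rw [hcl.closure_eq]
    exact fun h => hxX ⟨hx, h⟩
  obtain ⟨f, d, hf, hfP, hfX⟩ := exists_homogeneous_of_notMem_closure hP
  obtain ⟨a, ha⟩ := Projectivization.exists_smul_eq_mk_rep ℂ x hx
  refine ⟨f, ?_, fun h0 => hfP ?_⟩
  · rw [mem_idealOf]
    intro v hv
    obtain ⟨Q, hQ, c, hc, hr⟩ := exists_rep_eq_smul hv
    have := hfX Q hQ
    rw [hr, IsHomogeneous.eval_smul hf] at this
    exact (mul_eq_zero.1 this).resolve_left (pow_ne_zero _ hc)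
  · rw [← ha]
    change eval ((a : ℂ) • x) f = 0
    rw [IsHomogeneous.eval_smul hf, h0, mul_zero]

variable {X : Set (PP 3)}

theorem smul_mem_dualCone {h : Fin 4 → ℂ} (hh : h ∈ dualCone X) (c : ℂ) : c • h ∈ dualCone X := by
  obtain ⟨v, hv, hv'⟩ := hh
  exact ⟨v, hv, Submodule.smul_mem _ _ hv'⟩

/-- The ideal of the dual surface is generated by an irreducible homogeneous polynomial. -/
theorem exists_dual_equation [hp : (idealOf X).IsPrime] (hne : (cone X).Nonempty)
    (hT : ∀ v ∈ cone X, Module.finrank ℂ (tangentAt X v) = 2)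
    (hplane : ∀ h : Fin 4 → ℂ, h ≠ 0 → ∃ v ∈ cone X, h ⬝ᵥ v ≠ 0) :
    ∃ (Φ : MvPolynomial (Fin 4) ℂ) (d : ℕ), Φ.IsHomogeneous d ∧ Prime Φ ∧
      vanishingIdeal ℂ (dualCone X) = Ideal.span {Φ} := by
  have hX0 : MvPolynomial.X 0 ∉ idealOf X := by
    intro hi
    obtain ⟨v, hv, hne⟩ := hplane (Pi.single 0 1) (by simp)
    apply hne
    simpa using mem_idealOf.1 hi v hv
  have hprime := dualCone_isPrime hne
  obtain ⟨i, hi⟩ := exists_dominant_projection hne hT hplane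
  obtain ⟨Ψ, hΨ⟩ := exists_span_singleton_of_prime i _ hi
  obtain ⟨G, hG0, hG⟩ := exists_conormal_equation hX0 hT
  have hΨ0 : Ψ ≠ 0 := by
    rintro rfl
    have hGmem : G ∈ vanishingIdeal ℂ (dualCone X) := by
      rw [mem_vanishingIdeal_iff_eval]
      rintro h ⟨v, hv, hh⟩
      exact hG v hv h hh
    rw [hΨ] at hGmem
    simp at hGmem
    exact hG0 hGmem
  set d := Ψ.totalDegree with hd
  have hΨmem : Ψ ∈ vanishingIdeal ℂ (dualCone X) := hΨ ▸ Ideal.mem_span_singleton_self Ψ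
  -- The dual cone is stable under scaling, so its ideal contains the top component of the
  -- generator. That component is a multiple of `Ψ` of the same degree, hence associated to it.
  have hcomp : homogeneousComponent d Ψ ∈ vanishingIdeal ℂ (dualCone X) := by
    rw [mem_vanishingIdeal_iff_eval] at hΨmem ⊢
    intro h hh
    by_contra hcon
    obtain ⟨c, -, hc⟩ := exists_smul_eval_ne_zero hcon
    exact hc (hΨmem _ (smul_mem_dualCone hh c))
  have hcomp0 : homogeneousComponent d Ψ ≠ 0 := by
    obtain ⟨m, hm, hmd⟩ := Finset.exists_mem_eq_sup Ψ.support (support_nonempty.2 hΨ0)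
      fun s => s.sum fun _ e => e
    intro h0
    have h1 := coeff_homogeneousComponent d Ψ m
    rw [h0, if_pos (by rw [hd, totalDegree, hmd]; rfl)] at h1
    exact mem_support_iff.1 hm h1.symm
  have hassoc : Associated Ψ (homogeneousComponent d Ψ) := by
    rw [hΨ, Ideal.mem_span_singleton] at hcomp
    obtain ⟨k, hk⟩ := hcomp
    have hk0 : k ≠ 0 := by
      rintro rfl
      exact hcomp0 (by rw [hk, mul_zero])
    have hdeg := congrArg totalDegree hk
    rw [(homogeneousComponent_isHomogeneous d Ψ).totalDegree hcomp0,
      totalDegree_mul_of_isDomain hΨ0 hk0] at hdeg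
    have hk1 : k.totalDegree = 0 := by omega
    rw [totalDegree_eq_zero_iff_eq_C] at hk1
    have hku : IsUnit k := by
      rw [hk1]
      refine (isUnit_iff_ne_zero.2 fun h => hk0 ?_).map C
      rw [hk1, h, C_0]
    rw [hk]
    exact ⟨hku.unit, rfl⟩
  have hspan : vanishingIdeal ℂ (dualCone X) = Ideal.span {homogeneousComponent d Ψ} := by
    rw [hΨ]
    exact Ideal.span_singleton_eq_span_singleton.2 hassoc
  refine ⟨_, d, homogeneousComponent_isHomogeneous d Ψ, ?_, hspan⟩
  rw [← Ideal.span_singleton_prime hcomp0, ← hspan]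
  exact hprime

theorem eval_homogeneousComponent {ι : Type*} [Fintype ι] [DecidableEq ι] (N : ℕ)
    (f : MvPolynomial ι ℂ) (x : ι → ℂ) :
    eval x (homogeneousComponent N f) =
      ∑ β ∈ (Finset.univ : Finset ι).finsuppAntidiag N, coeff β f * ∏ i, x i ^ β i := by
  have hdeg : ∀ β : ι →₀ ℕ, β.degree = N ↔ β ∈ (Finset.univ : Finset ι).finsuppAntidiag N := by
    intro β
    rw [Finset.mem_finsuppAntidiag, Finsupp.degree_eq_sum]
    simp
  rw [homogeneousComponent_apply, map_sum]
  simp only [eval_monomial]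
  rw [Finset.sum_subset (s₂ := (Finset.univ : Finset ι).finsuppAntidiag N)]
  · exact Finset.sum_congr rfl fun β _ => by rw [Finsupp.prod_fintype _ _ (by simp)]
  · intro β hβ
    exact (hdeg β).1 (Finset.mem_filter.1 hβ).2
  · intro β hβ hβ'
    rw [Finset.mem_filter, not_and, mem_support_iff] at hβ'
    by_cases h : coeff β f = 0
    · simp [h]
    · exact absurd ((hdeg β).2 hβ) (hβ' h)

/-- The image of a closed family of projective varieties is closed: if every fibre equation has
no common nonzero solution at `h₀`, some polynomial vanishes on the image but not at `h₀`. -/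
theorem exists_separating_polynomial {ι τ : Type*} [Fintype ι]
    (V : Set ((τ → ℂ) × (ι → ℂ))) (hcone : ∀ (c : ℂ) (h : τ → ℂ) (x : ι → ℂ), c ≠ 0 →
      (h, x) ∈ V → (h, c • x) ∈ V) (hV0 : ∀ h x, (h, x) ∈ V → x ≠ 0) (h₀ : τ → ℂ)
    (hh₀ : ∀ x : ι → ℂ, x ≠ 0 → ∃ F : MvPolynomial ι (MvPolynomial τ ℂ),
      (∀ p ∈ V, eval p.2 (MvPolynomial.map (eval p.1) F) = 0) ∧
        eval x (MvPolynomial.map (eval h₀) F) ≠ 0) :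
    ∃ D : MvPolynomial τ ℂ, (∀ p ∈ V, eval p.1 D = 0) ∧ eval h₀ D ≠ 0 := by
  classical
  -- the specializations at `h₀` of all relations
  let J : Ideal (MvPolynomial ι (MvPolynomial τ ℂ)) :=
    { carrier := {F | ∀ p ∈ V, eval p.2 (MvPolynomial.map (eval p.1) F) = 0}
      add_mem' := fun {a b} ha hb p hp => by simp [ha p hp, hb p hp]
      zero_mem' := fun p _ => by simp
      smul_mem' := fun c a ha p hp => by simp [ha p hp] }
  have hsurj : Function.Surjective (MvPolynomial.map (σ := ι) (eval h₀)) :=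
    MvPolynomial.map_surjective _ fun c => ⟨C c, by simp⟩
  let J₀ : Ideal (MvPolynomial ι ℂ) := J.map (MvPolynomial.map (eval h₀))
  have hJ₀ : ∀ f ∈ J₀, ∃ F ∈ J, MvPolynomial.map (eval h₀) F = f := fun f hf =>
    (Ideal.mem_map_iff_of_surjective _ hsurj).1 hf
  -- Nullstellensatz: the relations specialized at `h₀` have no common zero but possibly the origin,
  -- so they generate all monomials of some degree `N`.
  have hX : ∀ i, MvPolynomial.X i ∈ J₀.radical := by
    intro i
    rw [← vanishingIdeal_zeroLocus_eq_radical (K := ℂ), mem_vanishingIdeal_iff_eval]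
    intro x hx
    rw [eval_X]
    by_contra hxi
    obtain ⟨F, hF, hne⟩ := hh₀ x (fun h => hxi (by rw [h]; rfl))
    apply hne
    have := hx _ (Ideal.mem_map_of_mem _ (show F ∈ J from hF))
    simpa using this
  have hle : idealOfVars ι ℂ ≤ J₀.radical := by
    rw [idealOfVars, Ideal.span_le]
    rintro _ ⟨i, rfl⟩
    exact hX i
  obtain ⟨N, hN⟩ := Ideal.exists_pow_le_of_le_radical_of_fg hle (idealOfVars_fg ι ℂ)
  let B := {α // α ∈ (Finset.univ : Finset ι).finsuppAntidiag N}
  have hBdeg : ∀ α : B, ∑ i, α.1 i = N := fun α => (Finset.mem_finsuppAntidiag.1 α.2).1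
  have hmon : ∀ α : B, ∃ F ∈ J, MvPolynomial.map (eval h₀) F = monomial α.1 1 := by
    intro α
    refine hJ₀ _ (hN ?_)
    rw [monomial_mem_pow_idealOfVars_iff _ _ one_ne_zero, Finsupp.degree_eq_sum, hBdeg α]
  choose F hFJ hF using hmon
  have hFV : ∀ α, ∀ p ∈ V, eval p.2 (MvPolynomial.map (eval p.1) (F α)) = 0 :=
    fun α p hp => hFJ α p hp
  -- The rows are the degree `N` coefficients of relations lifting the monomials of degree `N`. At
  -- `h₀` this is the identity matrix. Over a point `(h, x)` of `V` it kills the nonzero vector of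
  -- monomials in `x`, because the degree `N` parts vanish on the cone.
  let A : Matrix B B (MvPolynomial τ ℂ) := Matrix.of fun α β => coeff β.1 (F α)
  have hdet : ∀ h : τ → ℂ, eval h A.det =
      (Matrix.of fun α β : B => coeff β.1 (MvPolynomial.map (eval h) (F α))).det := by
    intro h
    rw [RingHom.map_det]
    congr 1
  refine ⟨A.det, ?_, ?_⟩
  · rintro ⟨h, x⟩ hp
    rw [hdet]
    apply Matrix.exists_mulVec_eq_zero_iff.1
    refine ⟨fun β => ∏ i, x i ^ β.1 i, ?_, ?_⟩
    · obtain ⟨i, hi⟩ := Function.ne_iff.1 (hV0 h x hp)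
      intro h0
      have h1 := congrFun h0 ⟨Finsupp.single i N, by
        rw [Finset.mem_finsuppAntidiag]
        exact ⟨by simp [Finsupp.single_apply], by simp⟩⟩
      simp only [Pi.zero_apply] at h1
      obtain ⟨j, -, hj⟩ := Finset.prod_eq_zero_iff.1 h1
      by_cases hij : i = j
      · subst hij
        exact hi (eq_zero_of_pow_eq_zero hj)
      · simp [hij] at hj
    · ext α
      have hzero : eval x (homogeneousComponent N (MvPolynomial.map (eval h) (F α))) = 0 := by
        by_contra hcon
        obtain ⟨c, hc, hne⟩ := exists_smul_eval_ne_zero hcon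
        exact hne (hFV α (h, c • x) (hcone c h x hc hp))
      rw [eval_homogeneousComponent, ← Finset.sum_coe_sort] at hzero
      exact hzero
  · rw [hdet]
    have : (Matrix.of fun α β : B => coeff β.1 (MvPolynomial.map (eval h₀) (F α))) = 1 := by
      ext α β
      rw [Matrix.of_apply, hF, coeff_monomial, Matrix.one_apply]
      exact if_congr Subtype.ext_iff.symm rfl rfl
    rw [this, Matrix.det_one]
    exact one_ne_zero

/-- The dual cone is closed. -/
theorem mem_dualCone_of_forall_eval_eq_zero
    (hT : ∀ v ∈ cone X, Module.finrank ℂ (tangentAt X v) = 2) (hcl : IsClosed X) {h₀ : Fin 4 → ℂ}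
    (h : ∀ D ∈ vanishingIdeal ℂ (dualCone X), eval h₀ D = 0) : h₀ ∈ dualCone X := by
  classical
  by_contra hcon
  let V : Set ((Fin 4 → ℂ) × (Fin 4 → ℂ)) := {p | p.2 ∈ cone X ∧ p.1 ∈ conormalAt X p.2}
  obtain ⟨D, hD, hD0⟩ := exists_separating_polynomial V
    (fun c h x hc hp => ⟨smul_mem_cone hp.1 hc, by
      rw [conormalAt_smul hc]
      exact hp.2⟩) (fun h x hp => ne_zero_of_mem_cone hp.1) h₀ (by
    intro x hx
    -- Two kinds of equations cut out the incidence variety: on the curve, pairing the plane with a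
    -- tangent field; off the curve, an equation of `X`.
    by_cases hxX : x ∈ cone X
    · have hx' : h₀ ∉ conormalAt X x := fun h' => hcon ⟨x, hxX, h'⟩
      rw [mem_conormalAt_iff_forall] at hx'
      push Not at hx'
      obtain ⟨w, hw, hhw⟩ := hx'
      obtain ⟨W, hW, rfl⟩ := exists_tangent_field hT hxX hw
      have hev : ∀ (h u : Fin 4 → ℂ), eval u (MvPolynomial.map (eval h)
          (∑ i, C (MvPolynomial.X i) * MvPolynomial.map C (W i))) = h ⬝ᵥ evalField u W := by
        intro h u
        have hid : (eval h).comp (C : ℂ →+* MvPolynomial (Fin 4) ℂ) = RingHom.id ℂ := by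
          ext; simp
        simp only [map_sum, map_mul, map_C, eval_C, eval_X, map_map, hid, map_id]
        rfl
      refine ⟨∑ i, C (MvPolynomial.X i) * MvPolynomial.map C (W i), ?_, ?_⟩
      · rintro ⟨h, u⟩ ⟨hu, hhu⟩
        rw [hev]
        exact mem_conormalAt_iff_forall.1 hhu _ (hW u hu)
      · rwa [hev]
    · obtain ⟨f, hf, hfx⟩ := exists_mem_idealOf_eval_ne_zero hcl hx hxX
      have hev : ∀ (h u : Fin 4 → ℂ), eval u (MvPolynomial.map (eval h)
          (MvPolynomial.map C f)) = eval u f := by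
        intro h u
        have hid : (eval h).comp (C : ℂ →+* MvPolynomial (Fin 4) ℂ) = RingHom.id ℂ := by
          ext; simp
        rw [map_map, hid, map_id]
      refine ⟨MvPolynomial.map C f, ?_, ?_⟩
      · rintro ⟨h, u⟩ ⟨hu, -⟩
        rw [hev]
        exact mem_idealOf.1 hf u hu
      · rwa [hev])
  refine hD0 (h D ?_)
  rw [mem_vanishingIdeal_iff_eval]
  rintro g ⟨v, hv, hg⟩
  exact hD (g, v) ⟨hv, hg⟩

end

/-! ### Reduced plane sections of a prime form -/

theorem degree_ne_zero_of_prime {σ : Type*} {Φ : MvPolynomial σ ℂ} {d : ℕ}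
    (hΦ : Φ.IsHomogeneous d) (hprime : Prime Φ) : d ≠ 0 := by
  rintro rfl
  have h1 := totalDegree_eq_zero_iff_eq_C.1 (hΦ.totalDegree hprime.ne_zero)
  apply hprime.not_isUnit
  rw [h1]
  refine (isUnit_iff_ne_zero.2 fun h => hprime.ne_zero ?_).map C
  rw [h1, h, C_0]

/-- The linear change of variables that sends the first coordinate vector to `v`. -/
noncomputable def shear {n : ℕ} (v : Fin (n + 1) → ℂ) (hv : v 0 ≠ 0) :
    MvPolynomial (Fin (n + 1)) ℂ ≃ₐ[ℂ] MvPolynomial (Fin (n + 1)) ℂ :=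
  AlgEquiv.ofAlgHom
    (aeval (Fin.cons (C (v 0) * X 0) fun j => X j.succ + C (v j.succ) * X 0))
    (aeval (Fin.cons (C (v 0)⁻¹ * X 0) fun j => X j.succ - C (v j.succ * (v 0)⁻¹) * X 0))
    (by
      apply MvPolynomial.algHom_ext
      intro i
      refine Fin.cases ?_ (fun j => ?_) i
      · simp only [AlgHom.comp_apply, aeval_X, Fin.cons_zero, map_mul, aeval_C, AlgHom.id_apply,
          algebraMap_eq]
        rw [← mul_assoc, ← C_mul, inv_mul_cancel₀ hv, C_1, one_mul]
      · simp only [AlgHom.comp_apply, aeval_X, Fin.cons_succ, Fin.cons_zero, map_sub, map_mul,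
          aeval_C, AlgHom.id_apply, algebraMap_eq]
        rw [mul_assoc, ← mul_assoc (C (v 0)⁻¹), ← C_mul, inv_mul_cancel₀ hv, C_1, one_mul]
        ring)
    (by
      apply MvPolynomial.algHom_ext
      intro i
      refine Fin.cases ?_ (fun j => ?_) i
      · simp only [AlgHom.comp_apply, aeval_X, Fin.cons_zero, map_mul, aeval_C, AlgHom.id_apply,
          algebraMap_eq]
        rw [← mul_assoc, ← C_mul, mul_inv_cancel₀ hv, C_1, one_mul]
      · simp only [AlgHom.comp_apply, aeval_X, Fin.cons_succ, Fin.cons_zero, map_add, map_mul,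
          aeval_C, AlgHom.id_apply, algebraMap_eq]
        ring)

theorem map_finSuccEquiv_shear {n : ℕ} (v : Fin (n + 1) → ℂ) (hv : v 0 ≠ 0)
    (Φ : MvPolynomial (Fin (n + 1)) ℂ) (y : Fin n → ℂ) :
    (finSuccEquiv ℂ n (shear v hv Φ)).map (eval y) = restrictLine (Fin.cons 0 y) v Φ := by
  refine Polynomial.funext fun s => ?_
  rw [← eval_eq_eval_mv_eval', eval_restrictLine]
  change eval _ (aeval _ Φ) = _
  rw [← eval_evalField]
  congr 2
  ext i
  refine Fin.cases ?_ (fun j => ?_) i <;> simp [evalField, mul_comm]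

/-- A prime form restricts to a separable polynomial on some line. -/
theorem exists_separable_restrictLine {n : ℕ} {Φ : MvPolynomial (Fin (n + 1)) ℂ} {d : ℕ}
    (hΦ : Φ.IsHomogeneous d) (hprime : Prime Φ) :
    ∃ u v, eval v Φ ≠ 0 ∧ (restrictLine u v Φ).Separable := by
  have hd := degree_ne_zero_of_prime hΦ hprime
  -- The factor `X 0` ensures `v 0 ≠ 0`, which makes the change of variables invertible.
  obtain ⟨v, hv⟩ := exists_eval_ne_zero (mul_ne_zero hprime.ne_zero (X_ne_zero (R := ℂ) 0))
  rw [map_mul, eval_X] at hv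
  have hv0 := right_ne_zero_of_mul hv
  have hvΦ := left_ne_zero_of_mul hv
  set P := finSuccEquiv ℂ n (shear v hv0 Φ) with hP
  have hPprime : Prime P := by
    rw [hP, MulEquiv.prime_iff (finSuccEquiv ℂ n), MulEquiv.prime_iff (shear v hv0)]
    exact hprime
  have hdeg : P.natDegree ≠ 0 := by
    intro h0
    have h1 := map_finSuccEquiv_shear v hv0 Φ 0
    have h2 := coeff_restrictLine (Fin.cons 0 0 : Fin (n + 1) → ℂ) v hΦ
    rw [← h1, Polynomial.coeff_map, ← hP,
      Polynomial.coeff_eq_zero_of_natDegree_lt (by omega),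
      map_zero] at h2
    exact hvΦ h2.symm
  have hder : Polynomial.derivative P ≠ 0 := fun h0 =>
    hdeg (Polynomial.derivative_eq_zero.1 h0)
  -- The derivative is nonzero of smaller degree. Bezout then gives a nonzero `r` in the other
  -- variables, and the restriction is separable over every `y` with `r (y) ≠ 0`.
  have hnd : ¬ P ∣ Polynomial.derivative P := fun h =>
    absurd (Polynomial.natDegree_le_of_dvd h hder)
      (not_le.2 (Polynomial.natDegree_derivative_lt hdeg))
  obtain ⟨a, b, r, hr, hab⟩ := exists_bezout hPprime hdeg hnd
  obtain ⟨y, hy⟩ := exists_eval_ne_zero hr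
  refine ⟨Fin.cons 0 y, v, hvΦ, ?_⟩
  rw [← map_finSuccEquiv_shear v hv0 Φ y, ← hP, Polynomial.separable_def,
    Polynomial.derivative_map]
  have h1 := congrArg (Polynomial.map (eval y)) hab
  rw [Polynomial.map_add, Polynomial.map_mul, Polynomial.map_mul, Polynomial.map_C] at h1
  refine ⟨Polynomial.C (eval y r)⁻¹ * a.map (eval y), Polynomial.C (eval y r)⁻¹ * b.map (eval y), ?_⟩
  have h2 : Polynomial.C (eval y r)⁻¹ * Polynomial.C (eval y r) = 1 := by
    rw [← Polynomial.C_mul, inv_mul_cancel₀ hy, Polynomial.C_1]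
  linear_combination Polynomial.C (eval y r)⁻¹ * h1 + h2

/-- A multiple of the projection of `h` onto the orthogonal space of `o` along the `i`-th
coordinate vector. -/
noncomputable def orthProj {m : ℕ} (i : Fin m) (h o : Fin m → ℂ) : Fin m → ℂ :=
  o i • h - (h ⬝ᵥ o) • Pi.single i 1

theorem orthProj_dotProduct {m : ℕ} (i : Fin m) (h o : Fin m → ℂ) : orthProj i h o ⬝ᵥ o = 0 := by
  simp [orthProj, sub_dotProduct, smul_dotProduct, mul_comm]

/-- `orthProj` as a polynomial in the last argument. -/
noncomputable def orthProjField {m : ℕ} (i : Fin m) (h : Fin m → ℂ) :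
    Fin m → MvPolynomial (Fin m) ℂ :=
  fun j => X i * C (h j) - linearForm h * C ((Pi.single i 1 : Fin m → ℂ) j)

theorem evalField_orthProjField {m : ℕ} (i : Fin m) (h o : Fin m → ℂ) :
    evalField o (orthProjField i h) = orthProj i h o := by
  ext j
  simp [evalField, orthProjField, orthProj, eval_linearForm]

/-- One good line is orthogonal to some nonzero `o`, as two linear conditions in at least three
variables have a common solution. `orthProj` moves the line polynomially into the orthogonal of any
other centre; `G` is the discriminant times the leading coefficient along the moved line, and it is
nonzero at the first `o`. -/
theorem exists_separable_orthogonal_line {n : ℕ} {Φ : MvPolynomial (Fin (n + 3)) ℂ} {d : ℕ}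
    (hΦ : Φ.IsHomogeneous d) (hprime : Prime Φ) :
    ∃ G : MvPolynomial (Fin (n + 3)) ℂ, G ≠ 0 ∧ ∀ o, eval o G ≠ 0 → ∃ u v, u ⬝ᵥ o = 0 ∧
      v ⬝ᵥ o = 0 ∧ eval v Φ ≠ 0 ∧ (restrictLine u v Φ).Separable := by
  classical
  have hd := degree_ne_zero_of_prime hΦ hprime
  obtain ⟨u, v, hv, hsep⟩ := exists_separable_restrictLine hΦ hprime
  obtain ⟨o, ho, ho0⟩ : ∃ o : Fin (n + 3) → ℂ, (u ⬝ᵥ o = 0 ∧ v ⬝ᵥ o = 0) ∧ o ≠ 0 := by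
    have h1 := LinearMap.ker_ne_bot_of_finrank_lt (f := (Matrix.of ![u, v]).mulVecLin) (by simp)
    obtain ⟨o, ho, ho0⟩ := Submodule.exists_mem_ne_zero_of_ne_bot h1
    rw [LinearMap.mem_ker, Matrix.mulVecLin_apply] at ho
    exact ⟨o, ⟨congrFun ho 0, congrFun ho 1⟩, ho0⟩
  obtain ⟨i, hi⟩ := Function.ne_iff.1 ho0
  rw [Pi.zero_apply] at hi
  let P : Polynomial (MvPolynomial (Fin (n + 3)) ℂ) := aeval (fun j =>
    Polynomial.C (orthProjField i u j) + Polynomial.C (orthProjField i v j) * Polynomial.X) Φ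
  have hP : ∀ o, P.map (eval o) = restrictLine (orthProj i u o) (orthProj i v o) Φ := by
    intro o
    have : (Polynomial.mapRingHom (eval o)).comp
        (aeval (fun j => Polynomial.C (orthProjField i u j) +
          Polynomial.C (orthProjField i v j) * Polynomial.X) :
          _ →ₐ[ℂ] Polynomial (MvPolynomial (Fin (n + 3)) ℂ)).toRingHom =
        (restrictLine (orthProj i u o) (orthProj i v o) : _ →+* Polynomial ℂ) := by
      apply MvPolynomial.ringHom_ext
      · intro r
        simp [restrictLine]
      · intro j
        simp [restrictLine, ← evalField_orthProjField, evalField]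
    exact congrArg (fun φ => φ Φ) this
  have hPdeg : P.natDegree ≤ d := by
    rw [Polynomial.natDegree_le_iff_coeff_eq_zero]
    intro k hk
    refine MvPolynomial.funext fun o => ?_
    rw [← Polynomial.coeff_map, hP, map_zero]
    exact Polynomial.coeff_eq_zero_of_natDegree_lt
      ((natDegree_restrictLine_le _ _ Φ).trans_lt (hΦ.totalDegree_le.trans_lt hk))
  -- The formal degrees `d` and `d - 1` are kept so that the resultant commutes with evaluation at
  -- `o`, even where the degree drops.
  let R := Polynomial.resultant P (Polynomial.derivative P) d (d - 1)
  have hR : ∀ o, eval o R = Polynomial.resultant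
      (restrictLine (orthProj i u o) (orthProj i v o) Φ)
      (Polynomial.derivative (restrictLine (orthProj i u o) (orthProj i v o) Φ)) d (d - 1) := by
    intro o
    rw [← hP, Polynomial.derivative_map, Polynomial.resultant_map_map]
  refine ⟨R * aeval (orthProjField i v) Φ, ?_, ?_⟩
  · have hou : ∀ h : Fin (n + 3) → ℂ, h ⬝ᵥ o = 0 → orthProj i h o = o i • h := by
      intro h hh
      simp [orthProj, hh]
    have hline : restrictLine (orthProj i u o) (orthProj i v o) Φ =
        Polynomial.C (o i ^ d) * restrictLine u v Φ := by
      refine Polynomial.funext fun s => ?_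
      rw [Polynomial.eval_mul, Polynomial.eval_C, eval_restrictLine, eval_restrictLine,
        hou u ho.1, hou v ho.2, ← IsHomogeneous.eval_smul hΦ, smul_comm, ← smul_add]
    intro h0
    have h1 := congrArg (eval o) h0
    rw [map_mul, ← eval_evalField, evalField_orthProjField, hou v ho.2,
      IsHomogeneous.eval_smul hΦ, map_zero] at h1
    have hR0 := (mul_eq_zero.1 h1).resolve_right (mul_ne_zero (pow_ne_zero _ hi) hv)
    rw [hR, hline] at hR0
    set p := Polynomial.C (o i ^ d) * restrictLine u v Φ with hp
    have hpsep : p.Separable := by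
      rw [hp]
      exact hsep.unit_mul (Polynomial.isUnit_C.2 (isUnit_iff_ne_zero.2 (pow_ne_zero _ hi)))
    have hpd : p.natDegree = d := by
      apply le_antisymm
      · rw [← hline, ← hP]
        exact (Polynomial.natDegree_map_le).trans hPdeg
      · apply Polynomial.le_natDegree_of_ne_zero
        rw [hp, Polynomial.coeff_C_mul, coeff_restrictLine u v hΦ]
        exact mul_ne_zero (pow_ne_zero _ hi) hv
    have hpd' : (Polynomial.derivative p).natDegree = d - 1 := by
      rw [Polynomial.natDegree_derivative, hpd]
    have h2 : Polynomial.resultant p (Polynomial.derivative p) = 0 := by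
      rw [hpd, hpd']
      exact hR0
    exact (Polynomial.resultant_eq_zero_iff.1 h2).2 hpsep
  · intro o ho
    rw [map_mul, ← eval_evalField, evalField_orthProjField] at ho
    refine ⟨orthProj i u o, orthProj i v o, orthProj_dotProduct _ _ _, orthProj_dotProduct _ _ _,
      right_ne_zero_of_mul ho, ?_⟩
    have hRo := left_ne_zero_of_mul ho
    rw [hR] at hRo
    set p := restrictLine (orthProj i u o) (orthProj i v o) Φ with hp
    have hpd : p.natDegree ≤ d := by
      rw [hp, ← hP]
      exact (Polynomial.natDegree_map_le).trans hPdeg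
    obtain ⟨a, b, -, -, hab⟩ := Polynomial.exists_mul_add_mul_eq_C_resultant p
      (Polynomial.derivative p) hpd
      ((Polynomial.natDegree_derivative_le p).trans (Nat.sub_le_sub_right hpd 1)) (Or.inl hd)
    set r := Polynomial.resultant p (Polynomial.derivative p) d (d - 1)
    refine ⟨Polynomial.C r⁻¹ * a, Polynomial.C r⁻¹ * b, ?_⟩
    have h2 : Polynomial.C r⁻¹ * Polynomial.C r = 1 := by
      rw [← Polynomial.C_mul, inv_mul_cancel₀ hRo, Polynomial.C_1]
    linear_combination Polynomial.C r⁻¹ * hab + h2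

/-- The polynomial `l ↦ Φ (Mᵀ l)`. -/
noncomputable def pullback {m n : ℕ} (M : Matrix (Fin m) (Fin n) ℂ) (Φ : MvPolynomial (Fin n) ℂ) :
    MvPolynomial (Fin m) ℂ :=
  aeval (fun i => linearForm fun j => M j i) Φ

theorem eval_pullback {m n : ℕ} (M : Matrix (Fin m) (Fin n) ℂ) (Φ : MvPolynomial (Fin n) ℂ)
    (l : Fin m → ℂ) : eval l (pullback M Φ) = eval (l ᵥ* M) Φ := by
  rw [pullback, ← eval_evalField]
  congr 2
  ext i
  rw [evalField, eval_linearForm, dotProduct_comm]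
  rfl

theorem isHomogeneous_linearForm {m : ℕ} (q : Fin m → ℂ) : (linearForm q).IsHomogeneous 1 := by
  rw [linearForm, sumSMulX, Finsupp.linearCombination_apply, Finsupp.sum]
  refine IsHomogeneous.sum _ _ _ fun i _ => ?_
  rw [smul_eq_C_mul]
  exact isHomogeneous_C_mul_X _ _

theorem isHomogeneous_pullback {m n : ℕ} (M : Matrix (Fin m) (Fin n) ℂ)
    {Φ : MvPolynomial (Fin n) ℂ} {d : ℕ} (hΦ : Φ.IsHomogeneous d) :
    (pullback M Φ).IsHomogeneous d := by
  have := hΦ.aeval (fun i => linearForm fun j => M j i) fun i => isHomogeneous_linearForm _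
  rwa [one_mul] at this

/-- The form keeps its degree `d` on the line with direction `b`. A repeated factor restricts to a
unit by separability, and comparing total degree with degree on the line shows that it is constant.
-/
theorem squarefree_pullback {m n : ℕ} {M : Matrix (Fin m) (Fin n) ℂ} {Φ : MvPolynomial (Fin n) ℂ}
    {d : ℕ} (hΦ : Φ.IsHomogeneous d) {a b : Fin m → ℂ} (hb : eval (b ᵥ* M) Φ ≠ 0)
    (hsep : (restrictLine (a ᵥ* M) (b ᵥ* M) Φ).Separable) : Squarefree (pullback M Φ) := by
  have hline : restrictLine a b (pullback M Φ) = restrictLine (a ᵥ* M) (b ᵥ* M) Φ := by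
    refine Polynomial.funext fun s => ?_
    rw [eval_restrictLine, eval_restrictLine, eval_pullback, Matrix.add_vecMul,
      Matrix.smul_vecMul]
  have hne : pullback M Φ ≠ 0 := by
    intro h0
    rw [← eval_pullback, h0] at hb
    simp at hb
  have hdeg : (pullback M Φ).totalDegree ≤ d := (isHomogeneous_pullback M hΦ).totalDegree_le
  have hnat : d ≤ (restrictLine a b (pullback M Φ)).natDegree := by
    rw [hline]
    apply Polynomial.le_natDegree_of_ne_zero
    rwa [coeff_restrictLine _ _ hΦ]
  rintro q ⟨k, hk⟩
  have hq0 : q ≠ 0 := by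
    rintro rfl
    exact hne (by simpa using hk)
  have hk0 : k ≠ 0 := by
    rintro rfl
    exact hne (by simpa using hk)
  have hsq : IsUnit (restrictLine a b q) := by
    rw [← hline] at hsep
    exact hsep.squarefree _ ⟨restrictLine a b k, by rw [hk, map_mul, map_mul]⟩
  have hq1 : (restrictLine a b q).natDegree = 0 := Polynomial.natDegree_eq_zero_of_isUnit hsq
  rw [hk, totalDegree_mul_of_isDomain (mul_ne_zero hq0 hq0) hk0,
    totalDegree_mul_of_isDomain hq0 hq0] at hdeg
  rw [hk, map_mul, map_mul] at hnat
  have h1 := hnat.trans (Polynomial.natDegree_mul_le)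
  have h2 := Polynomial.natDegree_mul_le (p := restrictLine a b q) (q := restrictLine a b q)
  have h3 := natDegree_restrictLine_le a b k
  have hq2 : q.totalDegree = 0 := by omega
  rw [totalDegree_eq_zero_iff_eq_C] at hq2
  rw [hq2]
  refine (isUnit_iff_ne_zero.2 fun h => hq0 ?_).map C
  rw [hq2, h, C_0]

/-- The ideal of a proper nonempty subvariety is not stable under partial derivatives. -/
theorem exists_pderiv_notMem {n : ℕ} {Y : Set (PP n)} (hne : (cone Y).Nonempty)
    {f : MvPolynomial (Fin (n + 1)) ℂ} (hf : f ∈ idealOf Y) (hf0 : f ≠ 0) :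
    ∃ g ∈ idealOf Y, ∃ j, pderiv j g ∉ idealOf Y := by
  classical
  by_contra! hcon
  obtain ⟨x, hx⟩ := hne
  obtain ⟨y, hy⟩ := exists_eval_ne_zero hf0
  -- Under stability, all derivatives along the line from the point `x` of the cone to `y` vanish at
  -- `x`. Then `f` is zero on this line, although `f (y) ≠ 0`.
  have key : ∀ (m : ℕ) (g : MvPolynomial (Fin (n + 1)) ℂ), g ∈ idealOf Y →
      (restrictLine x (y - x) g).natDegree ≤ m → restrictLine x (y - x) g = 0 := by
    intro m
    induction m with
    | zero =>
      intro g hg hdeg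
      have h0 : (restrictLine x (y - x) g).eval 0 = 0 := by
        rw [eval_restrictLine, zero_smul, add_zero]
        exact mem_idealOf.1 hg x hx
      rw [Polynomial.eq_C_of_natDegree_le_zero hdeg] at h0 ⊢
      rw [Polynomial.eval_C] at h0
      rw [h0, Polynomial.C_0]
    | succ m ih =>
      intro g hg hdeg
      have hder : Polynomial.derivative (restrictLine x (y - x) g) = 0 := by
        have hg' : ∑ i, pderiv i g * C ((y - x) i) ∈ idealOf Y :=
          Ideal.sum_mem _ fun i _ => Ideal.mul_mem_right _ _ (hcon g hg i)
        have heq : Polynomial.derivative (restrictLine x (y - x) g) =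
            restrictLine x (y - x) (∑ i, pderiv i g * C ((y - x) i)) := by
          rw [derivative_restrictLine, map_sum]
          refine Finset.sum_congr rfl fun i _ => ?_
          rw [map_mul]
          congr 1
          simp [restrictLine]
        rw [heq]
        refine ih _ hg' ?_
        rw [← heq]
        exact (Polynomial.natDegree_derivative_le _).trans (by omega)
      refine ih g hg ?_
      rw [Polynomial.derivative_eq_zero.1 hder]
      exact Nat.zero_le m
  have h1 := eval_restrictLine x (y - x) f 1
  rw [key _ f hf le_rfl] at h1
  simp only [Polynomial.eval_zero, one_smul, add_sub_cancel] at h1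
  exact hy h1.symm

/-! ### The projected curve and its tangent lines -/

section Projection

variable {M : Matrix (Fin 3) (Fin 4) ℂ} {O : PP 3} {X : Set (PP 3)}

theorem IsProjectionFrom.mulVec_eq_zero_iff (hM : IsProjectionFrom M O) {w : Fin 4 → ℂ} :
    M *ᵥ w = 0 ↔ ∃ c : ℂ, c • O.rep = w := by
  rw [← Submodule.mem_span_singleton, ← Projectivization.submodule_eq, ← hM, LinearMap.mem_ker,
    Matrix.mulVecLin_apply]

theorem IsProjectionFrom.exists_right_inverse (hM : IsProjectionFrom M O) :
    ∃ N : Matrix (Fin 4) (Fin 3) ℂ, M * N = 1 := by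
  rw [← Matrix.mulVec_surjective_iff_exists_right_inverse]
  have h1 := LinearMap.finrank_range_add_finrank_ker M.mulVecLin
  rw [hM, Projectivization.finrank_submodule] at h1
  have h2 : LinearMap.range M.mulVecLin = ⊤ := by
    apply Submodule.eq_top_of_finrank_eq
    simp at h1 ⊢
    omega
  exact LinearMap.range_eq_top.1 h2

/-- `N M x - x` lies in the kernel of `M`, the line of `O`, on which `h` is zero. So a plane through
the centre is recovered from its trace in the image plane. -/
theorem IsProjectionFrom.vecMul_vecMul (hM : IsProjectionFrom M O) {N : Matrix (Fin 4) (Fin 3) ℂ}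
    (hN : M * N = 1) {h : Fin 4 → ℂ} (hh : h ⬝ᵥ O.rep = 0) : (h ᵥ* N) ᵥ* M = h := by
  rw [← sub_eq_zero]
  refine dotProduct_eq_zero _ fun x => ?_
  have hker : M *ᵥ (N *ᵥ (M *ᵥ x) - x) = 0 := by
    rw [Matrix.mulVec_sub, Matrix.mulVec_mulVec (M *ᵥ x) M N, hN, Matrix.one_mulVec, sub_self]
  obtain ⟨c, hc⟩ := hM.mulVec_eq_zero_iff.1 hker
  rw [sub_dotProduct, ← Matrix.dotProduct_mulVec, ← Matrix.dotProduct_mulVec, ← dotProduct_sub,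
    ← hc, dotProduct_smul, hh, smul_zero]

/-- A centre off all tangent lines is not on the curve, and no tangent direction is contracted. -/
theorem mulVec_ne_zero_of_mem_cone (hM : IsProjectionFrom M O)
    (hO : ∀ v ∈ cone X, O.rep ∉ tangentAt X v) {v w : Fin 4 → ℂ} (hv : v ∈ cone X)
    (hw : w ∈ tangentAt X v) (hw0 : w ≠ 0) : M *ᵥ w ≠ 0 := by
  intro h0
  obtain ⟨c, rfl⟩ := hM.mulVec_eq_zero_iff.1 h0
  have hc : c ≠ 0 := fun h => hw0 (by rw [h, zero_smul])
  apply hO v hv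
  have := Submodule.smul_mem _ c⁻¹ hw
  rwa [smul_smul, inv_mul_cancel₀ hc, one_smul] at this

theorem mem_cone_projectedCurve (hM : IsProjectionFrom M O)
    (hO : ∀ v ∈ cone X, O.rep ∉ tangentAt X v) {u : Fin 3 → ℂ} :
    u ∈ cone (projectedCurve M X) ↔ ∃ v ∈ cone X, M *ᵥ v = u := by
  constructor
  · rintro ⟨hu, P, hP, hMP, hmk⟩
    obtain ⟨c, hc⟩ := (Projectivization.mk_eq_mk_iff' ℂ _ _ _ _).1 hmk
    have hc0 : c ≠ 0 := by
      rintro rfl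
      exact hu (by rw [← hc, zero_smul])
    exact ⟨c • P.rep, smul_mem_cone (rep_mem_cone hP) hc0, by rw [Matrix.mulVec_smul, hc]⟩
  · rintro ⟨v, hv, rfl⟩
    obtain ⟨P, hP, c, hc, hr⟩ := exists_rep_eq_smul hv
    refine ⟨mulVec_ne_zero_of_mem_cone hM hO hv (self_mem_tangentAt hv) (ne_zero_of_mem_cone hv),
      P, hP, mulVec_ne_zero_of_mem_cone hM hO (rep_mem_cone hP)
        (self_mem_tangentAt (rep_mem_cone hP)) P.rep_nonzero, ?_⟩
    rw [Projectivization.mk_eq_mk_iff']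
    refine ⟨c⁻¹, ?_⟩
    rw [hr, Matrix.mulVec_smul, smul_smul, inv_mul_cancel₀ hc, one_smul]

theorem eval_pullback_transpose (f : MvPolynomial (Fin 3) ℂ) (v : Fin 4 → ℂ) :
    eval v (pullback Mᵀ f) = eval (M *ᵥ v) f := by
  rw [eval_pullback, Matrix.vecMul_transpose]

theorem mem_idealOf_projectedCurve (hM : IsProjectionFrom M O)
    (hO : ∀ v ∈ cone X, O.rep ∉ tangentAt X v) {f : MvPolynomial (Fin 3) ℂ} :
    f ∈ idealOf (projectedCurve M X) ↔ pullback Mᵀ f ∈ idealOf X := by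
  simp only [mem_idealOf, mem_cone_projectedCurve hM hO]
  constructor
  · intro h v hv
    exact (eval_pullback_transpose f v).trans (h _ ⟨v, hv, rfl⟩)
  · rintro h _ ⟨v, hv, rfl⟩
    exact (eval_pullback_transpose f v).symm.trans (h v hv)

theorem sum_pderiv_linearForm {m : ℕ} (q : Fin m → ℂ) (i : Fin m) :
    pderiv i (linearForm q) = C (q i) := by
  classical
  rw [linearForm, sumSMulX, Finsupp.linearCombination_apply, Finsupp.sum_fintype _ _ (by simp),
    map_sum]
  simp only [Derivation.map_smul, pderiv_X]
  rw [Finset.sum_eq_single i]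
  · simp [smul_eq_C_mul]
  · intro j _ hj
    simp [hj]
  · simp

theorem mulVec_mem_tangentAt (hM : IsProjectionFrom M O)
    (hO : ∀ v ∈ cone X, O.rep ∉ tangentAt X v) {v w : Fin 4 → ℂ} (hw : w ∈ tangentAt X v) :
    M *ᵥ w ∈ tangentAt (projectedCurve M X) (M *ᵥ v) := by
  intro f hf
  have h1 := hw _ ((mem_idealOf_projectedCurve hM hO).1 hf)
  have h2 : ∀ i, eval v (pderiv i (pullback Mᵀ f)) =
      ∑ j, eval (M *ᵥ v) (pderiv j f) * M j i := by
    intro i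
    rw [pullback, derivation_aeval (pderiv i), map_sum]
    refine Finset.sum_congr rfl fun j _ => ?_
    rw [sum_pderiv_linearForm, smul_eq_mul, map_mul, eval_C, ← eval_pullback_transpose]
    rfl
  rw [← h1]
  simp only [h2, Matrix.mulVec, dotProduct, Finset.mul_sum, Finset.sum_mul]
  rw [Finset.sum_comm]
  simp only [mul_assoc]

theorem exists_ne_zero_mem_idealOf_projectedCurve [hp : (idealOf X).IsPrime]
    (h0 : MvPolynomial.X 0 ∉ idealOf X)
    (hT : ∀ v ∈ cone X, Module.finrank ℂ (tangentAt X v) = 2) (hM : IsProjectionFrom M O)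
    (hO : ∀ v ∈ cone X, O.rep ∉ tangentAt X v) :
    ∃ G ∈ idealOf (projectedCurve M X), G ≠ 0 := by
  obtain ⟨G, hG0, hG⟩ := exists_eval_linear_combination_eq_zero h0 hT 1
    (fun _ i => dehomogenize (linearForm (M i)))
  refine ⟨G, ?_, hG0⟩
  rw [mem_idealOf_projectedCurve hM hO]
  refine mem_idealOf_of_mul_mem h0 fun v hv hv0 => ?_
  rw [eval_X] at hv0
  obtain ⟨y, hy, hvy⟩ := exists_chart_of_mem_cone hv hv0
  rw [eval_pullback_transpose]
  have h1 := hG y hy fun _ => v 0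
  have h2 : M *ᵥ v = fun i => ∑ j : Fin 1, v 0 * eval y (dehomogenize (linearForm (M i))) := by
    ext i
    simp only [Finset.univ_unique, Finset.sum_const, Finset.card_singleton, one_smul,
      eval_dehomogenize, eval_linearForm]
    conv_lhs => rw [hvy]
    rw [Matrix.mulVec_smul]
    rfl
  rw [h2]
  exact h1

/-- The image of the tangent space keeps dimension two and lies in the tangent space of the image
curve. One nonzero gradient bounds the latter by two, so they agree. -/
theorem tangentAt_projectedCurve (hT : ∀ v ∈ cone X, Module.finrank ℂ (tangentAt X v) = 2)
    (hM : IsProjectionFrom M O) (hO : ∀ v ∈ cone X, O.rep ∉ tangentAt X v) {v : Fin 4 → ℂ}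
    (hv : v ∈ cone X) {k : MvPolynomial (Fin 3) ℂ} (hk : k ∈ idealOf (projectedCurve M X))
    {j : Fin 3} (hkv : eval (M *ᵥ v) (pderiv j k) ≠ 0) :
    Module.finrank ℂ (tangentAt (projectedCurve M X) (M *ᵥ v)) = 2 ∧
      tangentAt (projectedCurve M X) (M *ᵥ v) = (tangentAt X v).map M.mulVecLin := by
  have hle : (tangentAt X v).map M.mulVecLin ≤ tangentAt (projectedCurve M X) (M *ᵥ v) := by
    rintro _ ⟨w, hw, rfl⟩
    exact mulVec_mem_tangentAt hM hO hw
  have hinj : Module.finrank ℂ ((tangentAt X v).map M.mulVecLin) = 2 := by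
    rw [← hT v hv, ← LinearMap.range_domRestrict]
    refine LinearMap.finrank_range_of_inj ?_
    rw [← LinearMap.ker_eq_bot, LinearMap.ker_eq_bot']
    rintro ⟨w, hw⟩ hw0
    by_contra hne
    exact mulVec_ne_zero_of_mem_cone hM hO hv hw (fun h => hne (Subtype.ext h)) hw0
  have hconormal : conormalAt (projectedCurve M X) (M *ᵥ v) ≠ ⊥ := by
    intro hbot
    have hmem : (fun i => eval (M *ᵥ v) (pderiv i k)) ∈
        conormalAt (projectedCurve M X) (M *ᵥ v) := mem_conormalAt.2 ⟨k, hk, rfl⟩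
    rw [hbot, Submodule.mem_bot] at hmem
    exact hkv (congrFun hmem j)
  have hpos : 0 < Module.finrank ℂ (conormalAt (projectedCurve M X) (M *ᵥ v)) := by
    rw [Nat.pos_iff_ne_zero, Ne, Submodule.finrank_eq_zero]
    exact hconormal
  have h1 : Module.finrank ℂ (tangentAt (projectedCurve M X) (M *ᵥ v)) =
      3 - Module.finrank ℂ (conormalAt (projectedCurve M X) (M *ᵥ v)) := finrank_tangentAt _
  have h2 := hinj.symm.le.trans (Submodule.finrank_mono hle)
  have h3 : Module.finrank ℂ (tangentAt (projectedCurve M X) (M *ᵥ v)) = 2 :=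
    le_antisymm (h1.trans_le (Nat.sub_le_sub_left hpos 3)) h2
  exact ⟨h3, (Submodule.eq_of_le_of_finrank_eq hle (by rw [hinj, h3])).symm⟩

theorem exists_smul_rep_eq {n : ℕ} {u : Fin (n + 1) → ℂ} (hu : u ≠ 0) :
    ∃ c : ℂ, c ≠ 0 ∧ (Projectivization.mk ℂ u hu).rep = c • u := by
  obtain ⟨a, ha⟩ := Projectivization.exists_smul_eq_mk_rep ℂ u hu
  exact ⟨a, a.ne_zero, ha.symm⟩

/-- A line tangent to the image curve pulls back to a plane containing the tangent line of `X`
above; the closure adds nothing, since the hypersurface is closed. -/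
theorem dualCurve_subset_hypersurface (hM : IsProjectionFrom M O)
    (hO : ∀ v ∈ cone X, O.rep ∉ tangentAt X v) {Φ : MvPolynomial (Fin 4) ℂ} {d : ℕ}
    (hΦ : Φ.IsHomogeneous d) (hΦX : ∀ h ∈ dualCone X, eval h Φ = 0) :
    dualCurve (projectedCurve M X) ⊆ hypersurface (pullback M Φ) := by
  have hclosed : IsClosed (hypersurface (pullback M Φ)) := by
    rw [← isOpen_compl_iff]
    exact isOpen_eval_rep_ne_zero (isHomogeneous_pullback M hΦ)
  refine closure_minimal ?_ hclosed
  rintro l ⟨P, ⟨⟨R, hR, hMR, rfl⟩, -⟩, hl⟩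
  change eval l.rep (pullback M Φ) = 0
  rw [eval_pullback]
  refine hΦX _ ⟨R.rep, rep_mem_cone hR, ?_⟩
  rw [mem_conormalAt_iff_forall]
  intro w hw
  rw [← Matrix.dotProduct_mulVec]
  apply hl
  obtain ⟨c, hc, hrep⟩ := exists_smul_rep_eq hMR
  rw [tangentSpace_eq, hrep, tangentAt_smul hc]
  exact mulVec_mem_tangentAt hM hO hw

end Projection

/-! ### Plane sections of the dual surface and duals of projections -/

section

variable {M : Matrix (Fin 3) (Fin 4) ℂ} {O : PP 3} {X : Set (PP 3)}

/-- A conormal vector orthogonal to the centre extends to a polynomial field of such vectors. -/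
theorem exists_orthogonal_conormal_field {v h o : Fin 4 → ℂ} (ho : o ∉ tangentAt X v)
    (hh : h ∈ conormalAt X v) (hho : h ⬝ᵥ o = 0) :
    ∃ W : Fin 4 → MvPolynomial (Fin 4) ℂ, (∀ u, evalField u W ∈ conormalAt X u) ∧
      (∀ u, evalField u W ⬝ᵥ o = 0) ∧ ∃ c : ℂ, c ≠ 0 ∧ evalField v W = c • h := by
  obtain ⟨A, hA, rfl⟩ := exists_conormal_field hh
  have hg : ∃ g ∈ conormalAt X v, g ⬝ᵥ o ≠ 0 := by
    by_contra! hcon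
    exact ho fun f hf => hcon _ (mem_conormalAt.2 ⟨f, hf, rfl⟩)
  obtain ⟨_, hg, hgo⟩ := hg
  obtain ⟨B, hB, rfl⟩ := exists_conormal_field hg
  -- The combination `(B · o) A - (A · o) B` is orthogonal to `o` everywhere. At `v` it is a
  -- multiple of `A`, by the nonzero factor `B · o`, which exists because `o` is not tangent.
  have hW : ∀ u, evalField u (fun i => (∑ j, B j * C (o j)) * A i - (∑ j, A j * C (o j)) * B i) =
      (evalField u B ⬝ᵥ o) • evalField u A - (evalField u A ⬝ᵥ o) • evalField u B := by
    intro u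
    ext i
    simp [evalField, dotProduct]
  refine ⟨fun i => (∑ j, B j * C (o j)) * A i - (∑ j, A j * C (o j)) * B i,
    fun u => ?_, fun u => ?_, evalField v B ⬝ᵥ o, hgo, ?_⟩
  · rw [hW]
    exact Submodule.sub_mem _ (Submodule.smul_mem _ _ (hA u)) (Submodule.smul_mem _ _ (hB u))
  · rw [hW, sub_dotProduct, smul_dotProduct, smul_dotProduct, smul_eq_mul, smul_eq_mul]
    ring
  · rw [hW, hho, zero_smul, sub_zero]

/-- A hyperplane through the centre that is tangent to the space curve at a point above a smooth
point of the projected curve projects to a tangent line. -/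
theorem mk_mem_tangent_lines (hT : ∀ v ∈ cone X, Module.finrank ℂ (tangentAt X v) = 2)
    (hM : IsProjectionFrom M O) (hO : ∀ v ∈ cone X, O.rep ∉ tangentAt X v) {u : Fin 4 → ℂ}
    (hu : u ∈ cone X) {k : MvPolynomial (Fin 3) ℂ} (hk : k ∈ idealOf (projectedCurve M X))
    {j : Fin 3} (hku : eval (M *ᵥ u) (pderiv j k) ≠ 0) {l : Fin 3 → ℂ} (hl : l ≠ 0)
    (hlu : l ᵥ* M ∈ conormalAt X u) :
    ∃ P, IsSmoothPoint (projectedCurve M X) P ∧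
      ∀ w ∈ tangentSpace (projectedCurve M X) P, (Projectivization.mk ℂ l hl).rep ⬝ᵥ w = 0 := by
  obtain ⟨h2, hmap⟩ := tangentAt_projectedCurve hT hM hO hu hk hku
  obtain ⟨hMu, hmem⟩ := (mem_cone_projectedCurve hM hO).2 ⟨u, hu, rfl⟩
  obtain ⟨c, hc, hrep⟩ := exists_smul_rep_eq hMu
  obtain ⟨b, -, hrepl⟩ := exists_smul_rep_eq hl
  have htan : tangentSpace (projectedCurve M X) (Projectivization.mk ℂ (M *ᵥ u) hMu) =
      tangentAt (projectedCurve M X) (M *ᵥ u) := by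
    rw [tangentSpace_eq, hrep, tangentAt_smul hc]
  refine ⟨_, ⟨hmem, ?_⟩, ?_⟩
  · rw [htan, h2]
  · rw [htan, hmap]
    rintro _ ⟨w, hw, rfl⟩
    rw [hrepl, smul_dotProduct, Matrix.mulVecLin_apply, Matrix.dotProduct_mulVec,
      mem_conormalAt_iff_forall.1 hlu w hw, smul_zero]

/-- The line `l` may come from a point `v` above a singular point of the image. It is then a limit
of good tangent lines: its plane extends to a polynomial field of tangent planes through `O`, which
give tangent lines at smooth points over a general point of `X`. Any form vanishing on those
vanishes along the whole field, hence at `l`. -/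
theorem hypersurface_subset_dualCurve [hp : (idealOf X).IsPrime]
    (hne : (cone X).Nonempty) (h0 : MvPolynomial.X 0 ∉ idealOf X)
    (hT : ∀ v ∈ cone X, Module.finrank ℂ (tangentAt X v) = 2) (hM : IsProjectionFrom M O)
    (hO : ∀ v ∈ cone X, O.rep ∉ tangentAt X v) {Φ : MvPolynomial (Fin 4) ℂ}
    (hΦX : ∀ h, eval h Φ = 0 → h ∈ dualCone X) :
    hypersurface (pullback M Φ) ⊆ dualCurve (projectedCurve M X) := by
  intro l hl
  change eval l.rep (pullback M Φ) = 0 at hl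
  rw [eval_pullback] at hl
  obtain ⟨v, hv, hlv⟩ := hΦX _ hl
  by_contra hcon
  obtain ⟨ψ, e, hψ, hψl, hψS⟩ := exists_homogeneous_of_notMem_closure hcon
  obtain ⟨N, hN⟩ := hM.exists_right_inverse
  have hlo : (l.rep ᵥ* M) ⬝ᵥ O.rep = 0 := by
    rw [← Matrix.dotProduct_mulVec, hM.mulVec_eq_zero_iff.2 ⟨1, one_smul _ _⟩, dotProduct_zero]
  have hlN : (l.rep ᵥ* M) ᵥ* N = l.rep := by
    rw [Matrix.vecMul_vecMul, hN, Matrix.vecMul_one]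
  obtain ⟨W, hW, hWo, c, hc, hWv⟩ := exists_orthogonal_conormal_field (hO v hv) hlv hlo
  have hWv0 : evalField v W ≠ 0 := by
    rw [hWv]
    refine smul_ne_zero hc fun h => l.rep_nonzero ?_
    rw [← hlN, h, Matrix.zero_vecMul]
  obtain ⟨i, hi⟩ := Function.ne_iff.1 hWv0
  obtain ⟨G, hG, hG0⟩ := exists_ne_zero_mem_idealOf_projectedCurve h0 hT hM hO
  obtain ⟨x, hx⟩ := hne
  obtain ⟨k, hk, j, hkj⟩ := exists_pderiv_notMem
    ⟨_, (mem_cone_projectedCurve hM hO).2 ⟨x, hx, rfl⟩⟩ hG hG0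
  let L : Fin 3 → MvPolynomial (Fin 4) ℂ := fun j => ∑ i, W i * C (N i j)
  have hL : ∀ u, evalField u L = evalField u W ᵥ* N := by
    intro u
    ext j
    simp [evalField, L, Matrix.vecMul, dotProduct]
  have hWi : W i ∉ idealOf X := fun h => hi (mem_idealOf.1 h v hv)
  have hmem : aeval L ψ ∈ idealOf X := by
    -- The excluded points lie where the gradient entry `∂ⱼ k` of the image curve vanishes, or where
    -- the `i`-th entry of `W` does.
    refine mem_idealOf_of_mul_mem (g := pullback Mᵀ (pderiv j k) * W i) ?_ fun u hu hgu => ?_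
    · intro h
      exact (hp.mem_or_mem h).elim (fun h => hkj ((mem_idealOf_projectedCurve hM hO).2 h)) hWi
    rw [map_mul, eval_pullback_transpose] at hgu
    have hLM : evalField u L ᵥ* M = evalField u W := by
      rw [hL, hM.vecMul_vecMul hN (hWo u)]
    have hLu : evalField u L ≠ 0 := by
      intro h
      rw [h, Matrix.zero_vecMul] at hLM
      exact right_ne_zero_of_mul hgu (congrFun hLM i).symm
    have hS := hψS _ (mk_mem_tangent_lines hT hM hO hu hk (left_ne_zero_of_mul hgu) hLu
      (by rw [hLM]; exact hW u))
    obtain ⟨b, hb, hrep⟩ := exists_smul_rep_eq hLu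
    rw [hrep, IsHomogeneous.eval_smul hψ] at hS
    rw [← eval_evalField]
    exact (mul_eq_zero.1 hS).resolve_left (pow_ne_zero _ hb)
  have hfin := mem_idealOf.1 hmem v hv
  rw [← eval_evalField, hL, hWv, Matrix.smul_vecMul, hlN, IsHomogeneous.eval_smul hψ] at hfin
  exact hψl ((mul_eq_zero.1 hfin).resolve_left (pow_ne_zero _ hc))

end

/-- A square-free homogeneous polynomial is determined by its nonempty zero locus in projective
space. -/
theorem exists_eq_C_mul_of_hypersurface_eq {n d e : ℕ} {φ ψ : MvPolynomial (Fin (n + 1)) ℂ}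
    (hφ : φ.IsHomogeneous d) (hψ : ψ.IsHomogeneous e) (hφs : Squarefree φ) (hψs : Squarefree ψ)
    (hne : (hypersurface ψ).Nonempty) (h : hypersurface φ = hypersurface ψ) :
    ∃ c : ℂ, c ≠ 0 ∧ φ = C c * ψ := by
  -- The Nullstellensatz is affine, so the origin must be a zero too. A nonzero form with a
  -- projective zero has positive degree and therefore vanishes there.
  have hzero : ∀ {f : MvPolynomial (Fin (n + 1)) ℂ} {m : ℕ}, f.IsHomogeneous m → f ≠ 0 →
      (hypersurface f).Nonempty → eval 0 f = 0 := by
    rintro f m hf hf0 ⟨P, hP⟩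
    have hm : m ≠ 0 := by
      rintro rfl
      rw [← totalDegree_zero_iff_isHomogeneous] at hf
      rw [totalDegree_eq_zero_iff_eq_C.1 hf] at hP hf0
      have hP' : coeff 0 f = 0 := (eval_C _).symm.trans hP
      rw [hP', C_0] at hf0
      exact hf0 rfl
    have := IsHomogeneous.eval_smul hf 0 0
    rwa [zero_smul, zero_pow hm, zero_mul] at this
  have key : ∀ {f g : MvPolynomial (Fin (n + 1)) ℂ} {m k : ℕ}, f.IsHomogeneous m →
      g.IsHomogeneous k → Squarefree f → Squarefree g → hypersurface f = hypersurface g →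
      (hypersurface g).Nonempty → f ∣ g := by
    intro f g m k hf hg hfs hgs hfg hgne
    have hz : ∀ v, eval v f = 0 → eval v g = 0 := by
      intro v hv
      by_cases hv0 : v = 0
      · rw [hv0]
        exact hzero hg hgs.ne_zero hgne
      obtain ⟨c, hc, hrep⟩ := exists_smul_rep_eq hv0
      have hmem : Projectivization.mk ℂ v hv0 ∈ hypersurface f := by
        change eval _ f = 0
        rw [hrep, IsHomogeneous.eval_smul hf, hv, mul_zero]
      rw [hfg] at hmem
      change eval _ g = 0 at hmem
      rw [hrep, IsHomogeneous.eval_smul hg] at hmem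
      exact (mul_eq_zero.1 hmem).resolve_left (pow_ne_zero _ hc)
    have hrad : (Ideal.span {f}).IsRadical :=
      isRadical_iff_span_singleton.1 ((isRadical_iff_squarefree_of_ne_zero hfs.ne_zero).2 hfs)
    rw [← Ideal.mem_span_singleton, ← hrad.radical,
      ← vanishingIdeal_zeroLocus_eq_radical (K := ℂ), mem_vanishingIdeal_iff_eval]
    intro x hx
    apply hz
    have := hx f (Ideal.mem_span_singleton_self f)
    simpa using this
  have h1 : ψ ∣ φ := key hψ hφ hψs hφs h.symm (h ▸ hne)
  have h2 : φ ∣ ψ := key hφ hψ hφs hψs h hne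
  obtain ⟨u, hu⟩ := associated_of_dvd_dvd h1 h2
  obtain ⟨r, hr, hur⟩ := isUnit_iff_eq_C_of_isReduced.1 u.isUnit
  exact ⟨r, hr.ne_zero, by rw [← hu, hur, mul_comm]⟩

/-! ### Equation of the dual of a generic projection -/

section Equation

variable {M : Matrix (Fin 3) (Fin 4) ℂ} {O : PP 3} {X : Set (PP 3)}

theorem exists_conormal_dotProduct_eq_zero {v : Fin 4 → ℂ}
    (h : Module.finrank ℂ (tangentAt X v) = 2) (o : Fin 4 → ℂ) :
    ∃ h ∈ conormalAt X v, h ≠ 0 ∧ h ⬝ᵥ o = 0 := by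
  obtain ⟨f, hf, g, hg, hfg⟩ := exists_linearIndependent_gradients h
  set a : Fin 4 → ℂ := fun i => eval v (pderiv i f)
  set b : Fin 4 → ℂ := fun i => eval v (pderiv i g)
  have ha : a ∈ conormalAt X v := mem_conormalAt.2 ⟨f, hf, rfl⟩
  have hb : b ∈ conormalAt X v := mem_conormalAt.2 ⟨g, hg, rfl⟩
  by_cases hao : a ⬝ᵥ o = 0
  · exact ⟨a, ha, hfg.ne_zero 0, hao⟩
  refine ⟨(b ⬝ᵥ o) • a + (-(a ⬝ᵥ o)) • b,
    Submodule.add_mem _ (Submodule.smul_mem _ _ ha) (Submodule.smul_mem _ _ hb), fun h0 => ?_, ?_⟩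
  · exact hao (neg_eq_zero.1 (LinearIndependent.pair_iff.1 hfg _ _ h0).2)
  · rw [add_dotProduct, smul_dotProduct, smul_dotProduct, smul_eq_mul, smul_eq_mul]
    ring

/-- The dual of a generic projection of a space curve is the section of the dual surface by the
plane dual to the centre. -/
theorem IsEquationOf.exists_eq_C_mul_pullback [hp : (idealOf X).IsPrime]
    (hne : (cone X).Nonempty) (h0 : MvPolynomial.X 0 ∉ idealOf X)
    (hT : ∀ v ∈ cone X, Module.finrank ℂ (tangentAt X v) = 2) (hM : IsProjectionFrom M O)
    (hO : ∀ v ∈ cone X, O.rep ∉ tangentAt X v) {Φ : MvPolynomial (Fin 4) ℂ} {d : ℕ}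
    (hΦ : Φ.IsHomogeneous d) (hΦX : ∀ h, h ∈ dualCone X ↔ eval h Φ = 0)
    (hline : ∃ u v, u ⬝ᵥ O.rep = 0 ∧ v ⬝ᵥ O.rep = 0 ∧ eval v Φ ≠ 0 ∧
      (restrictLine u v Φ).Separable) {φ : MvPolynomial (Fin 3) ℂ}
    (hφ : IsEquationOf φ (dualCurve (projectedCurve M X))) :
    ∃ c : ℂ, c ≠ 0 ∧ φ = C c * pullback M Φ := by
  obtain ⟨⟨e, hφe⟩, hφs, hφd⟩ := hφ
  obtain ⟨N, hN⟩ := hM.exists_right_inverse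
  obtain ⟨u, v, hu, hv, hvΦ, hsep⟩ := hline
  rw [← hM.vecMul_vecMul hN hu, ← hM.vecMul_vecMul hN hv] at hsep
  rw [← hM.vecMul_vecMul hN hv] at hvΦ
  refine exists_eq_C_mul_of_hypersurface_eq hφe (isHomogeneous_pullback M hΦ) hφs
    (squarefree_pullback hΦ hvΦ hsep) ?_ ?_
  -- The locus is nonempty: some plane through the centre is tangent to `X` at `x`.
  · obtain ⟨x, hx⟩ := hne
    obtain ⟨h, hhx, hh0, hho⟩ := exists_conormal_dotProduct_eq_zero (hT x hx) O.rep
    have hl := hM.vecMul_vecMul hN hho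
    have hl0 : h ᵥ* N ≠ 0 := by
      intro h1
      rw [h1, Matrix.zero_vecMul] at hl
      exact hh0 hl.symm
    obtain ⟨c, hc, hrep⟩ := exists_smul_rep_eq hl0
    refine ⟨Projectivization.mk ℂ _ hl0, ?_⟩
    change eval _ _ = 0
    rw [hrep, eval_pullback, Matrix.smul_vecMul, hl, IsHomogeneous.eval_smul hΦ,
      (hΦX h).1 ⟨x, hx, hhx⟩, mul_zero]
  · rw [← hφd]
    exact (dualCurve_subset_hypersurface hM hO hΦ fun h => (hΦX h).1).antisymm
      (hypersurface_subset_dualCurve hne h0 hT hM hO fun h => (hΦX h).2)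

end Equation

/-! ### The fundamental matrix and the epipolar plane -/

section FundamentalMatrix

theorem det_of_rows (a b c x : Fin 4 → ℂ) : (Matrix.of ![a, b, c, x]).det =
    a 0 * (b 1 * (c 2 * x 3 - c 3 * x 2) - b 2 * (c 1 * x 3 - c 3 * x 1) +
      b 3 * (c 1 * x 2 - c 2 * x 1)) -
    a 1 * (b 0 * (c 2 * x 3 - c 3 * x 2) - b 2 * (c 0 * x 3 - c 3 * x 0) +
      b 3 * (c 0 * x 2 - c 2 * x 0)) +
    a 2 * (b 0 * (c 1 * x 3 - c 3 * x 1) - b 1 * (c 0 * x 3 - c 3 * x 0) +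
      b 3 * (c 0 * x 1 - c 1 * x 0)) -
    a 3 * (b 0 * (c 1 * x 2 - c 2 * x 1) - b 1 * (c 0 * x 2 - c 2 * x 0) +
      b 2 * (c 0 * x 1 - c 1 * x 0)) := by
  rw [Matrix.det_succ_row_zero, Fin.sum_univ_four]
  simp only [Matrix.det_fin_three, Matrix.submatrix_apply]
  have s00 : Fin.succAbove (0 : Fin 4) (0 : Fin 3) = 1 := rfl
  have s01 : Fin.succAbove (0 : Fin 4) (1 : Fin 3) = 2 := rfl
  have s02 : Fin.succAbove (0 : Fin 4) (2 : Fin 3) = 3 := rfl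
  have s10 : Fin.succAbove (1 : Fin 4) (0 : Fin 3) = 0 := rfl
  have s11 : Fin.succAbove (1 : Fin 4) (1 : Fin 3) = 2 := rfl
  have s12 : Fin.succAbove (1 : Fin 4) (2 : Fin 3) = 3 := rfl
  have s20 : Fin.succAbove (2 : Fin 4) (0 : Fin 3) = 0 := rfl
  have s21 : Fin.succAbove (2 : Fin 4) (1 : Fin 3) = 1 := rfl
  have s22 : Fin.succAbove (2 : Fin 4) (2 : Fin 3) = 3 := rfl
  have s30 : Fin.succAbove (3 : Fin 4) (0 : Fin 3) = 0 := rfl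
  have s31 : Fin.succAbove (3 : Fin 4) (1 : Fin 3) = 1 := rfl
  have s32 : Fin.succAbove (3 : Fin 4) (2 : Fin 3) = 2 := rfl
  have r0 : ∀ j, Matrix.of ![a, b, c, x] 0 j = a j := fun _ => rfl
  have r1 : ∀ j, Matrix.of ![a, b, c, x] (Fin.succ 0) j = b j := fun _ => rfl
  have r2 : ∀ j, Matrix.of ![a, b, c, x] (Fin.succ 1) j = c j := fun _ => rfl
  have r3 : ∀ j, Matrix.of ![a, b, c, x] (Fin.succ 2) j = x j := fun _ => rfl
  have n0 : ((0 : Fin 4) : ℕ) = 0 := rfl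
  have n1 : ((1 : Fin 4) : ℕ) = 1 := rfl
  have n2 : ((2 : Fin 4) : ℕ) = 2 := rfl
  have n3 : ((3 : Fin 4) : ℕ) = 3 := rfl
  simp only [s00, s01, s02, s10, s11, s12, s20, s21, s22, s30, s31, s32, r0, r1, r2, r3, n0, n1,
    n2, n3]
  ring

/-- Five vectors of `ℂ⁴` satisfy Cramer's linear relation. It converts combinations of three rows of
`M₂` into combinations of two rows of `M₁`. -/
theorem cramer_relation (a b c x y : Fin 4 → ℂ) (t : Fin 4) :
    (Matrix.of ![b, c, x, y]).det * a t + (Matrix.of ![c, a, x, y]).det * b t +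
      (Matrix.of ![a, b, x, y]).det * c t =
    (Matrix.of ![a, b, c, y]).det * x t - (Matrix.of ![a, b, c, x]).det * y t := by
  simp only [det_of_rows]
  fin_cases t <;> simp only [Fin.zero_eta, Fin.mk_one, Fin.reduceFinMk] <;> ring

/-- The vector representing the linear form `x ↦ det (a, b, c, x)`. -/
noncomputable def tripleCross (a b c : Fin 4 → ℂ) : Fin 4 → ℂ :=
  fun i => (Matrix.of ![a, b, c, Pi.single i 1]).det

theorem dotProduct_tripleCross (a b c x : Fin 4 → ℂ) :
    x ⬝ᵥ tripleCross a b c = (Matrix.of ![a, b, c, x]).det := by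
  simp only [dotProduct, tripleCross, det_of_rows, Fin.sum_univ_four]
  simp
  ring

/-- The maximal minors of `M` give a kernel vector. If it were zero, then for `k` with `O.rep k ≠ 0`
some nonzero kernel vector would have `k`-th entry zero, yet the kernel is spanned by `O.rep`. -/
theorem IsProjectionFrom.exists_tripleCross_eq_smul {M : Matrix (Fin 3) (Fin 4) ℂ} {O : PP 3}
    (hM : IsProjectionFrom M O) :
    ∃ c : ℂ, c ≠ 0 ∧ tripleCross (M 0) (M 1) (M 2) = c • O.rep := by
  have hker : M *ᵥ tripleCross (M 0) (M 1) (M 2) = 0 := by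
    ext i
    change M i ⬝ᵥ _ = 0
    rw [dotProduct_tripleCross]
    fin_cases i
    · exact Matrix.det_zero_of_row_eq (i := 0) (j := 3) (by decide) rfl
    · exact Matrix.det_zero_of_row_eq (i := 1) (j := 3) (by decide) rfl
    · exact Matrix.det_zero_of_row_eq (i := 2) (j := 3) (by decide) rfl
  obtain ⟨c, hc⟩ := hM.mulVec_eq_zero_iff.1 hker
  refine ⟨c, ?_, hc.symm⟩
  rintro rfl
  obtain ⟨k, hk⟩ := Function.ne_iff.1 O.rep_nonzero
  have hdet : (Matrix.of ![M 0, M 1, M 2, Pi.single k 1]).det = 0 := by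
    rw [← dotProduct_tripleCross, ← hc, zero_smul, dotProduct_zero]
  obtain ⟨w, hw0, hw⟩ := Matrix.exists_mulVec_eq_zero_iff.2 hdet
  have hMw : M *ᵥ w = 0 := by
    ext i
    fin_cases i
    · exact congrFun hw 0
    · exact congrFun hw 1
    · exact congrFun hw 2
  have hwk : w k = 0 := by
    have : (Pi.single k 1 : Fin 4 → ℂ) ⬝ᵥ w = 0 := congrFun hw 3
    simpa using this
  obtain ⟨b, rfl⟩ := hM.mulVec_eq_zero_iff.1 hMw
  have hb : b = 0 := (mul_eq_zero.1 hwk).resolve_right hk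
  exact hw0 (by rw [hb, zero_smul])

/-- The plane spanned by the centres and an optical ray, pulled back from either image plane. -/
theorem fundamentalMatrix_vecMul (M₁ M₂ : Matrix (Fin 3) (Fin 4) ℂ) (p : Fin 3 → ℂ) :
    (fundamentalMatrix M₁ M₂ *ᵥ p) ᵥ* M₂ =
      ((M₁ *ᵥ tripleCross (M₂ 0) (M₂ 1) (M₂ 2)) ⨯₃ p) ᵥ* M₁ := by
  have hm : ∀ i, (M₁ *ᵥ tripleCross (M₂ 0) (M₂ 1) (M₂ 2)) i =
      (Matrix.of ![M₂ 0, M₂ 1, M₂ 2, M₁ i]).det := fun i => dotProduct_tripleCross _ _ _ _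
  ext t
  -- The coefficient of `p j` on both sides is Cramer's relation for the rows of `M₂` and the rows
  -- `j + 1`, `j + 2` of `M₁`.
  have h0 := cramer_relation (M₂ 0) (M₂ 1) (M₂ 2) (M₁ 1) (M₁ 2) t
  have h1 := cramer_relation (M₂ 0) (M₂ 1) (M₂ 2) (M₁ 2) (M₁ 0) t
  have h2 := cramer_relation (M₂ 0) (M₂ 1) (M₂ 2) (M₁ 0) (M₁ 1) t
  have hF : ∀ i j, fundamentalMatrix M₁ M₂ i j =
    (Matrix.of ![M₂ (i + 1), M₂ (i + 2), M₁ (j + 1), M₁ (j + 2)]).det := fun _ _ => rfl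
  have e1 : (1 : Fin 3) + 1 = 2 := rfl
  have e2 : (1 : Fin 3) + 2 = 0 := rfl
  have e3 : (2 : Fin 3) + 1 = 0 := rfl
  have e4 : (2 : Fin 3) + 2 = 1 := rfl
  have hsum : ((fundamentalMatrix M₁ M₂ *ᵥ p) ᵥ* M₂) t =
      ∑ i, (∑ j, fundamentalMatrix M₁ M₂ i j * p j) * M₂ i t := rfl
  rw [hsum, cross_apply, hm, hm, hm]
  simp only [Matrix.vecMul, dotProduct, Fin.sum_univ_three, hF, zero_add, e1, e2, e3, e4,
    Matrix.cons_val_zero, Matrix.cons_val_one, Matrix.cons_val_two, Matrix.head_cons,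
    Matrix.tail_cons]
  linear_combination p 0 * h0 + p 1 * h1 + p 2 * h2

/-- The scalar `κ` compares the chosen representative of the epipole with the one given by the
minors of `M₂`. -/
theorem exists_fundamentalMatrix_vecMul {M₁ M₂ : Matrix (Fin 3) (Fin 4) ℂ} {O : PP 3}
    (hM₂ : IsProjectionFrom M₂ O) {e : Fin 3 → ℂ} (he : IsEpipole e M₁ O) :
    ∃ κ : ℂ, κ ≠ 0 ∧ ∀ p, (fundamentalMatrix M₁ M₂ *ᵥ p) ᵥ* M₂ = κ • ((e ⨯₃ p) ᵥ* M₁) := by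
  obtain ⟨c, hc, hcross⟩ := hM₂.exists_tripleCross_eq_smul
  obtain ⟨he0, v, hv, rfl⟩ := he
  rw [Projectivization.submodule_eq, Submodule.mem_span_singleton] at hv
  obtain ⟨b, rfl⟩ := hv
  have hb : b ≠ 0 := by
    rintro rfl
    exact he0 (by rw [zero_smul, Matrix.mulVec_zero])
  refine ⟨c * b⁻¹, mul_ne_zero hc (inv_ne_zero hb), fun p => ?_⟩
  rw [fundamentalMatrix_vecMul, hcross, Matrix.mulVec_smul, Matrix.mulVec_smul, map_smul, map_smul,
    LinearMap.smul_apply, LinearMap.smul_apply, Matrix.smul_vecMul, Matrix.smul_vecMul, smul_smul,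
    mul_assoc, inv_mul_cancel₀ hb, mul_one]

end FundamentalMatrix

/-! ### Generic centres -/

theorem isWeightedHomogeneous_rename {σ τ R : Type*} [CommSemiring R] {f : σ → τ} {w : τ → ℕ}
    {p : MvPolynomial σ R} {m : ℕ} (hp : IsWeightedHomogeneous (w ∘ f) p m) :
    IsWeightedHomogeneous w (rename f p) m := by
  intro d hd
  obtain ⟨u, rfl, hu⟩ := coeff_rename_ne_zero f p d hd
  rw [← hp hu, Finsupp.weight_apply, Finsupp.weight_apply,
    Finsupp.sum_mapDomain_index (by simp) (by simp [add_mul])]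
  rfl

theorem isWeightedHomogeneous_zero_weight {σ R : Type*} [CommSemiring R] (p : MvPolynomial σ R) :
    IsWeightedHomogeneous (fun _ => 0 : σ → ℕ) p 0 := by
  intro d _
  simp [Finsupp.weight_apply]

/-- Pairs of points outside a hypersurface form a nonempty open set. -/
theorem exists_isOpen_prod_hypersurface_compl {H : MvPolynomial (Fin 4) ℂ} {k : ℕ}
    (hH : H.IsHomogeneous k) (hH0 : H ≠ 0) :
    ∃ U : Set (PP 3 × PP 3), IsOpen[zariskiProd] U ∧ U.Nonempty ∧
      ∀ O ∈ U, eval O.1.rep H ≠ 0 ∧ eval O.2.rep H ≠ 0 := by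
  -- The factor `X 0` only guarantees that `x` is a nonzero vector.
  obtain ⟨x, hx⟩ := exists_eval_ne_zero (mul_ne_zero hH0 (X_ne_zero (R := ℂ) (0 : Fin 4)))
  rw [map_mul, eval_X] at hx
  have hx0 : x ≠ 0 := fun h => right_ne_zero_of_mul hx (by rw [h]; rfl)
  obtain ⟨c, hc, hrep⟩ := exists_smul_rep_eq hx0
  have hP : eval (Projectivization.mk ℂ x hx0).rep H ≠ 0 := by
    rw [hrep, IsHomogeneous.eval_smul hH]
    exact mul_ne_zero (pow_ne_zero _ hc) (left_ne_zero_of_mul hx)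
  have heval : ∀ O : PP 3 × PP 3, eval (Sum.elim O.1.rep O.2.rep)
      (rename Sum.inl H * rename Sum.inr H) = eval O.1.rep H * eval O.2.rep H := by
    intro O
    rw [map_mul, eval_rename, eval_rename, Sum.elim_comp_inl, Sum.elim_comp_inr]
  have hl : IsWeightedHomogeneous ((Sum.elim (fun _ => 1) (fun _ => 0) : Fin 4 ⊕ Fin 4 → ℕ) ∘
      Sum.inl) H k := hH
  have hr : IsWeightedHomogeneous ((Sum.elim (fun _ => 0) (fun _ => 1) : Fin 4 ⊕ Fin 4 → ℕ) ∘
      Sum.inr) H k := hH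
  have hl0 : IsWeightedHomogeneous ((Sum.elim (fun _ => 0) (fun _ => 1) : Fin 4 ⊕ Fin 4 → ℕ) ∘
      Sum.inl) H 0 := isWeightedHomogeneous_zero_weight H
  have hr0 : IsWeightedHomogeneous ((Sum.elim (fun _ => 1) (fun _ => 0) : Fin 4 ⊕ Fin 4 → ℕ) ∘
      Sum.inr) H 0 := isWeightedHomogeneous_zero_weight H
  refine ⟨{O | eval (Sum.elim O.1.rep O.2.rep) (rename Sum.inl H * rename Sum.inr H) ≠ 0},
    TopologicalSpace.isOpen_generateFrom_of_mem ⟨_, k + 0, 0 + k, ?_, ?_, rfl⟩,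
    ⟨(Projectivization.mk ℂ x hx0, Projectivization.mk ℂ x hx0), ?_⟩, fun O hO => ?_⟩
  · exact (isWeightedHomogeneous_rename hl).mul (isWeightedHomogeneous_rename hr0)
  · exact (isWeightedHomogeneous_rename hl0).mul (isWeightedHomogeneous_rename hr)
  · rw [Set.mem_ofPred_eq, heval]
    exact mul_ne_zero hP hP
  · rw [Set.mem_ofPred_eq, heval] at hO
    exact ⟨left_ne_zero_of_mul hO, right_ne_zero_of_mul hO⟩

/-- The centres of projection for which the dual of the projected curve is a reduced plane section
of the dual surface contain the complement of a hypersurface. -/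
theorem exists_generic_centre {X : Set (PP 3)} [hp : (idealOf X).IsPrime]
    (h0 : MvPolynomial.X 0 ∉ idealOf X)
    (hT : ∀ v ∈ cone X, Module.finrank ℂ (tangentAt X v) = 2) {Φ : MvPolynomial (Fin 4) ℂ} {d : ℕ}
    (hΦ : Φ.IsHomogeneous d) (hprime : Prime Φ) :
    ∃ (H : MvPolynomial (Fin 4) ℂ) (k : ℕ), H.IsHomogeneous k ∧ H ≠ 0 ∧
      ∀ o, eval o H ≠ 0 → (∀ v ∈ cone X, o ∉ tangentAt X v) ∧
        ∃ u v, u ⬝ᵥ o = 0 ∧ v ⬝ᵥ o = 0 ∧ eval v Φ ≠ 0 ∧ (restrictLine u v Φ).Separable := by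
  obtain ⟨A, hA0, hA⟩ := exists_tangent_developable h0 hT
  obtain ⟨B, hB0, hB⟩ := exists_separable_orthogonal_line (n := 1) hΦ hprime
  -- `A` and `B` need not be homogeneous, but the conditions on `o` are invariant under scaling, so
  -- a nonzero component of `A * B` suffices.
  have hAB : ∃ k, homogeneousComponent k (A * B) ≠ 0 := by
    by_contra! hcon
    refine mul_ne_zero hA0 hB0 ?_
    rw [← sum_homogeneousComponent (A * B)]
    exact Finset.sum_eq_zero fun k _ => hcon k
  obtain ⟨k, hk⟩ := hAB
  refine ⟨_, k, homogeneousComponent_isHomogeneous k (A * B), hk, fun o ho => ?_⟩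
  obtain ⟨c, hc, hco⟩ := exists_smul_eval_ne_zero ho
  rw [map_mul] at hco
  refine ⟨fun v hv hov => left_ne_zero_of_mul hco (hA v hv _ (Submodule.smul_mem _ c hov)), ?_⟩
  obtain ⟨u, v, hu, hv, hvΦ, hsep⟩ := hB _ (right_ne_zero_of_mul hco)
  rw [dotProduct_smul, smul_eq_mul] at hu hv
  exact ⟨u, v, (mul_eq_zero.1 hu).resolve_left hc, (mul_eq_zero.1 hv).resolve_left hc, hvΦ, hsep⟩

end Kruppa

/-! ### The generalized Kruppa equation -/

theorem mainTheorem3 (X : Set (Kruppa.PP 3)) (hX : Kruppa.IsSmoothIrreducibleCurve X)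
    (hXplane : ¬ Kruppa.IsPlanar X) :
    ∃ U : Set (Kruppa.PP 3 × Kruppa.PP 3), IsOpen[Kruppa.zariskiProd] U ∧ U.Nonempty ∧
      ∀ (O₁ O₂ : Kruppa.PP 3), (O₁, O₂) ∈ U →
      ∀ (M₁ M₂ : Matrix (Fin 3) (Fin 4) ℂ),
        Kruppa.IsProjectionFrom M₁ O₁ → Kruppa.IsProjectionFrom M₂ O₂ →
      ∀ (φ₁ φ₂ : MvPolynomial (Fin 3) ℂ),
        Kruppa.IsEquationOf φ₁ (Kruppa.dualCurve (Kruppa.projectedCurve M₁ X)) →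
        Kruppa.IsEquationOf φ₂ (Kruppa.dualCurve (Kruppa.projectedCurve M₂ X)) →
      ∀ e₁ : Fin 3 → ℂ, Kruppa.IsEpipole e₁ M₁ O₂ →
      ∃ c : ℂ, c ≠ 0 ∧ ∀ p : Fin 3 → ℂ,
        MvPolynomial.eval (Kruppa.fundamentalMatrix M₁ M₂ *ᵥ p) φ₂ =
          c * MvPolynomial.eval (e₁ ⨯₃ p) φ₁ := by
  have hp := Kruppa.idealOf_isPrime hX.irreducible
  obtain ⟨P, hP⟩ := hX.irreducible.nonempty
  have hne : (Kruppa.cone X).Nonempty := ⟨P.rep, Kruppa.rep_mem_cone hP⟩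
  have hT : ∀ v ∈ Kruppa.cone X, Module.finrank ℂ (Kruppa.tangentAt X v) = 2 := by
    intro v hv
    obtain ⟨Q, hQ, c, hc, hrep⟩ := Kruppa.exists_rep_eq_smul hv
    have h := (hX.smooth Q hQ).2
    rwa [Kruppa.tangentSpace_eq, hrep, Kruppa.tangentAt_smul hc] at h
  have hplane : ∀ h : Fin 4 → ℂ, h ≠ 0 → ∃ v ∈ Kruppa.cone X, h ⬝ᵥ v ≠ 0 := by
    intro h hh
    by_contra! hcon
    exact hXplane ⟨h, hh, fun Q hQ => hcon _ (Kruppa.rep_mem_cone hQ)⟩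
  have h0 : MvPolynomial.X 0 ∉ Kruppa.idealOf X := by
    intro h
    obtain ⟨v, hv, hv0⟩ := hplane (Pi.single 0 1) (by simp)
    apply hv0
    rw [single_dotProduct, one_mul, ← Kruppa.mem_idealOf.1 h v hv, MvPolynomial.eval_X]
  obtain ⟨Φ, d, hΦ, hprime, hspan⟩ := Kruppa.exists_dual_equation hne hT hplane
  have hΦX : ∀ h, h ∈ Kruppa.dualCone X ↔ MvPolynomial.eval h Φ = 0 := by
    refine fun h => ⟨fun hh => ?_, fun hh => ?_⟩
    · exact Kruppa.mem_vanishingIdeal_iff_eval.1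
        (hspan ▸ Ideal.mem_span_singleton_self Φ : Φ ∈ _) h hh
    · refine Kruppa.mem_dualCone_of_forall_eval_eq_zero hT hX.closed fun D hD => ?_
      rw [hspan, Ideal.mem_span_singleton] at hD
      obtain ⟨q, rfl⟩ := hD
      rw [map_mul, hh, zero_mul]
  obtain ⟨H, k, hHk, hH0, hH⟩ := Kruppa.exists_generic_centre h0 hT hΦ hprime
  obtain ⟨U, hUo, hUne, hU⟩ := Kruppa.exists_isOpen_prod_hypersurface_compl hHk hH0
  refine ⟨U, hUo, hUne, fun O₁ O₂ hO M₁ M₂ hM₁ hM₂ φ₁ φ₂ hφ₁ hφ₂ e₁ he₁ => ?_⟩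
  obtain ⟨hO₁, hO₂⟩ := hU _ hO
  obtain ⟨ht₁, hl₁⟩ := hH _ hO₁
  obtain ⟨ht₂, hl₂⟩ := hH _ hO₂
  obtain ⟨c₁, hc₁, rfl⟩ := hφ₁.exists_eq_C_mul_pullback hne h0 hT hM₁ ht₁ hΦ hΦX hl₁
  obtain ⟨c₂, hc₂, rfl⟩ := hφ₂.exists_eq_C_mul_pullback hne h0 hT hM₂ ht₂ hΦ hΦX hl₂
  obtain ⟨κ, hκ, hF⟩ := Kruppa.exists_fundamentalMatrix_vecMul hM₂ he₁
  -- `φ₂ (F p) = c₂ Φ (κ M₁ᵀ (e₁ × p)) = c₂ κ ^ d Φ (M₁ᵀ (e₁ × p))`, and the last value of `Φ` is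
  -- `c₁⁻¹ φ₁ (e₁ × p)`.
  refine ⟨c₂ * κ ^ d * c₁⁻¹, mul_ne_zero (mul_ne_zero hc₂ (pow_ne_zero _ hκ)) (inv_ne_zero hc₁),
    fun p => ?_⟩
  rw [map_mul, map_mul, MvPolynomial.eval_C, MvPolynomial.eval_C, Kruppa.eval_pullback,
    Kruppa.eval_pullback, hF, Kruppa.IsHomogeneous.eval_smul hΦ]
  field_simp
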